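/- Let $\triangle_H=\{(z,w)\in\mathbb C^2: |z|<|w|<1\}$ be the Hartogs triangle and let $H^2(\triangle_H)$ be the Hilbert space of all holomorphic functions $f$ on $\triangle_H$ with $$\|f\|^2=\sup_{s,t\in(0,1)}\frac1{4\pi^2}\int_0^{2\pi}\!\!\int_0^{2\pi}\bigl|f(st\,e^{i\theta},t\,e^{i\gamma})\bigr|^2\,st^2\,d\theta\,d\gamma<\infty .$$ A submodule of $H^2(\triangle_H)$ is a closed subspace $\mathcal S$ that is invariant under the operators $M_z,M_w$ of multiplication by the coordinates; put $S_z=M_z|_{\mathcal S}$ and $S_w=M_w|_{\mathcal S}$. It is called doubly commuting if $S_z^*S_w=S_wS_z^*$ on $\mathcal S$. The rank of $\mathcal S$ is the least number of elements of a set $E\subseteq\mathcal S$ for which the closed linear span of $\{S_z^{k_1}S_w^{k_2}e: e\in E,\ k_1,k_2\ge 0\}$ is $\mathcal S$. **Corollary 2.5 (Rank).** Every doubly commuting submodule $\mathcal S\neq\{0\}$ of $H^2(\triangle_H)$ has rank $1$; that is, $\mathcal S$ is cyclic for $(S_z,S_w)$: there is $g\in\mathcal S$ such that $\mathcal S$ is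 the closed linear span of $\{S_z^{k_1}S_w^{k_2}g: k_1,k_2\ge 0\}$. -/

import Mathlib

open MeasureTheory Set

noncomputable section
namespace Hartogs

/-- The Hartogs triangle `△_H = {(z, w) | |z| < |w| < 1}`. -/
def hartogsTriangle : Set (ℂ × ℂ) := {p | ‖p.1‖ < ‖p.2‖ ∧ ‖p.2‖ < 1}

/-- `(1 / 4π²) ∫₀^{2π} ∫₀^{2π} |f(s t e^{iθ}, t e^{iγ})|² s t² dθ dγ`. -/
def hardyMean (f : ℂ × ℂ → ℂ) (s t : ℝ) : ℝ :=
  1 / (4 * Real.pi ^ 2) * ∫ θ in (0 : ℝ)..2 * Real.pi, ∫ γ in (0 : ℝ)..2 * Real.pi,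
    ‖f (s * t * Complex.exp (θ * Complex.I), t * Complex.exp (γ * Complex.I))‖ ^ 2 * (s * t ^ 2)

/-- All the values of `hardyMean f s t` for `s, t ∈ (0, 1)`. -/
def hardyMeans (f : ℂ × ℂ → ℂ) : Set ℝ :=
  {x | ∃ s ∈ Ioo (0 : ℝ) 1, ∃ t ∈ Ioo (0 : ℝ) 1, x = hardyMean f s t}

/-- The mean of `F` over the torus `|z| = ρ`, `|w| = t`. -/
def torusMean {E : Type*} [NormedAddCommGroup E] [NormedSpace ℝ E]
    (F : ℂ × ℂ → E) (ρ t : ℝ) : E :=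
  (1 / (4 * Real.pi ^ 2)) • ∫ θ in (0 : ℝ)..2 * Real.pi, ∫ γ in (0 : ℝ)..2 * Real.pi,
    F (ρ * Complex.exp (θ * Complex.I), t * Complex.exp (γ * Complex.I))

/-- The normalized Haar measure of the torus. -/
abbrev torusMeasure : Measure (UnitAddTorus (Fin 2)) := Measure.pi fun _ => AddCircle.haarAddCircle

/-- The parametrization of the torus `|z| = ρ`, `|w| = t`. -/
def torusPoint (ρ t : ℝ) (x : UnitAddTorus (Fin 2)) : ℂ × ℂ :=
  (ρ * (AddCircle.toCircle (x 0) : ℂ), t * (AddCircle.toCircle (x 1) : ℂ))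

theorem continuous_torusPoint (ρ t : ℝ) : Continuous (torusPoint ρ t) := by
  unfold torusPoint
  have := AddCircle.continuous_toCircle (T := 1)
  fun_prop

theorem integral_haar {E : Type*} [NormedAddCommGroup E] [NormedSpace ℝ E]
    (h : Circle → E) : ∫ x : UnitAddCircle, h (AddCircle.toCircle x) ∂AddCircle.haarAddCircle =
      (1 / (2 * Real.pi)) • ∫ θ in (0 : ℝ)..2 * Real.pi, h (Circle.exp θ) := by
  have h1 := UnitAddCircle.intervalIntegral_preimage 0 (fun x => h (AddCircle.toCircle x))
  have h2 : (volume : Measure UnitAddCircle) = AddCircle.haarAddCircle := by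
    rw [AddCircle.volume_eq_smul_haarAddCircle]; simp
  rw [h2] at h1
  rw [← h1]
  simp only [AddCircle.toCircle_apply_mk, div_one, zero_add]
  have := intervalIntegral.integral_comp_mul_left (a := 0) (b := 1) (fun θ => h (Circle.exp θ))
    (c := 2 * Real.pi) (by positivity)
  rw [this]; simp

theorem torusMean_eq {E : Type*} [NormedAddCommGroup E] [NormedSpace ℝ E] [CompleteSpace E]
    (F : ℂ × ℂ → E) (ρ t : ℝ) (hF : Continuous fun x => F (torusPoint ρ t x)) :
    torusMean F ρ t = ∫ x, F (torusPoint ρ t x) ∂torusMeasure := by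
  have h1 := (measurePreserving_finTwoArrow
    (AddCircle.haarAddCircle (T := 1))).symm.integral_comp' (fun x => F (torusPoint ρ t x))
  rw [← h1, integral_prod]
  · have e1 : ∀ c : ℂ, ∫ y : UnitAddCircle, F (ρ * c, t * (AddCircle.toCircle y : ℂ))
        ∂AddCircle.haarAddCircle = (1 / (2 * Real.pi)) • ∫ θ in (0 : ℝ)..2 * Real.pi,
          F (ρ * c, t * (Circle.exp θ : ℂ)) :=
      fun c => integral_haar (fun u : Circle => F (ρ * c, t * (u : ℂ)))
    have e2 := integral_haar (fun c : Circle => (1 / (2 * Real.pi)) •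
      ∫ θ in (0 : ℝ)..2 * Real.pi, F (ρ * (c : ℂ), t * (Circle.exp θ : ℂ)))
    refine Eq.trans ?_ (e2.symm.trans (integral_congr_ae (.of_forall fun x => (e1 _).symm)))
    rw [intervalIntegral.integral_smul, smul_smul]
    unfold torusMean
    simp only [Circle.coe_exp]
    congr 1
    field_simp; norm_num
  · apply Continuous.integrable_of_hasCompactSupport
    · apply hF.comp
      show Continuous (fun p : UnitAddCircle × UnitAddCircle => ![p.1, p.2])
      fun_prop
    · exact HasCompactSupport.of_compactSpace _

theorem torusMean_swap {E : Type*} [NormedAddCommGroup E] [NormedSpace ℝ E]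
    (F : ℂ × ℂ → E) (ρ t : ℝ) (hF : Continuous fun x => F (torusPoint ρ t x)) :
    torusMean F ρ t = (1 / (4 * Real.pi ^ 2)) • ∫ γ in (0 : ℝ)..2 * Real.pi,
      ∫ θ in (0 : ℝ)..2 * Real.pi,
    F (ρ * Complex.exp (θ * Complex.I), t * Complex.exp (γ * Complex.I)) := by
  unfold torusMean
  rw [intervalIntegral_intervalIntegral_swap]
  have : Continuous (Function.uncurry fun θ γ : ℝ =>
      F (ρ * Complex.exp (θ * Complex.I), t * Complex.exp (γ * Complex.I))) := by
    have h2 : Continuous fun p : ℝ × ℝ => ((![(↑(p.1 / (2 * Real.pi)) : UnitAddCircle),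
      ↑(p.2 / (2 * Real.pi))]) : UnitAddTorus (Fin 2)) := by
      have := AddCircle.continuous_mk' (1:ℝ)
      refine continuous_pi fun i => ?_
      fin_cases i
      · exact this.comp (by fun_prop)
      · exact this.comp (by fun_prop)
    refine (hF.comp h2).congr fun p => ?_
    have hp : (Real.pi : ℂ) ≠ 0 := by exact_mod_cast Real.pi_ne_zero
    have hx : ∀ x : ℝ, ((AddCircle.toCircle (↑(x / (2 * Real.pi)) : UnitAddCircle) : Circle) : ℂ)
        = Complex.exp (x * Complex.I) := by
      intro x
      rw [AddCircle.toCircle_apply_mk, Circle.coe_exp]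
      congr 2
      push_cast
      field_simp
    simp only [Function.comp_apply, Function.uncurry, torusPoint, Matrix.cons_val_zero,
      Matrix.cons_val_one, hx]
  exact (this.continuousOn.integrableOn_compact (isCompact_uIcc.prod isCompact_uIcc)).mono_set
    (prod_mono uIoc_subset_uIcc uIoc_subset_uIcc)



theorem isOpen_hartogsTriangle : IsOpen hartogsTriangle :=
  (isOpen_lt continuous_fst.norm continuous_snd.norm).inter
    (isOpen_lt continuous_snd.norm continuous_const)

theorem torusPoint_mem {ρ t : ℝ} (h0 : 0 < ρ) (h1 : ρ < t) (h2 : t < 1)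
    (x : UnitAddTorus (Fin 2)) : torusPoint ρ t x ∈ hartogsTriangle := by
  have : 0 < t := h0.trans h1
  have hc : ∀ c : Circle, ‖(c : ℂ)‖ = 1 := Circle.norm_coe
  simp only [torusPoint, hartogsTriangle, Set.mem_ofPred_eq, norm_mul, Complex.norm_real,
    Real.norm_eq_abs, abs_of_pos h0, abs_of_pos this, hc, mul_one]
  exact ⟨h1, h2⟩

theorem torusPoint_ne {ρ t : ℝ} (h0 : 0 < ρ) (h1 : ρ < t)
    (x : UnitAddTorus (Fin 2)) : (torusPoint ρ t x).1 ≠ 0 ∧ (torusPoint ρ t x).2 ≠ 0 := by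
  have : 0 < t := h0.trans h1
  simp [torusPoint, h0.ne', this.ne']

/-- The points of `△_H` with nonzero first coordinate. -/
def punctured : Set (ℂ × ℂ) := hartogsTriangle ∩ {p | p.1 ≠ 0}

theorem isOpen_punctured : IsOpen punctured :=
  isOpen_hartogsTriangle.inter (isOpen_ne_fun (by fun_prop) (by fun_prop))

theorem continuous_comp_torusPoint {E : Type*} [TopologicalSpace E] {G : ℂ × ℂ → E}
    (hG : ContinuousOn G punctured) {ρ t : ℝ} (h0 : 0 < ρ) (h1 : ρ < t) (h2 : t < 1) :
    Continuous fun x => G (torusPoint ρ t x) :=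
  hG.comp_continuous (continuous_torusPoint ρ t)
    fun x => ⟨torusPoint_mem h0 h1 h2 x, (torusPoint_ne h0 h1 x).1⟩

theorem integral_circle_indep {h : ℂ → ℂ} {r R : ℝ} (h0 : 0 < r) (hr : r ≤ R)
    (hd : ∀ z, r ≤ ‖z‖ → ‖z‖ ≤ R → DifferentiableAt ℂ h z) :
    ∫ θ in (0 : ℝ)..2 * Real.pi, h (R * Complex.exp (θ * Complex.I)) =
    ∫ θ in (0 : ℝ)..2 * Real.pi, h (r * Complex.exp (θ * Complex.I)) := by
  have key := Complex.circleIntegral_sub_center_inv_smul_eq_of_differentiable_on_annulus_off_countable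
    (c := 0) (f := h) h0 hr countable_empty
    (fun z hz => (hd z (by simpa using hz.2) (by simpa using hz.1)).continuousAt.continuousWithinAt)
    (fun z hz => hd z (by simpa using (not_le.1 (by simpa using hz.1.2)).le)
      (by simpa using (mem_ball_zero_iff.1 hz.1.1).le))
  have e : ∀ ρ : ℝ, 0 < ρ → (∮ z in C(0, ρ), (z - 0)⁻¹ • h z) =
      Complex.I * ∫ θ in (0 : ℝ)..2 * Real.pi, h (ρ * Complex.exp (θ * Complex.I)) := by
    intro ρ hρ
    rw [circleIntegral, ← intervalIntegral.integral_const_mul]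
    refine intervalIntegral.integral_congr fun θ _ => ?_
    have : (ρ : ℂ) ≠ 0 := by exact_mod_cast hρ.ne'
    have := Complex.exp_ne_zero (θ * Complex.I)
    simp [circleMap]
    field_simp
  rw [e _ h0, e _ (h0.trans_le hr)] at key
  exact mul_left_cancel₀ Complex.I_ne_zero key

theorem norm_mul_exp {r : ℝ} (h : 0 < r) (θ : ℝ) : ‖(r : ℂ) * Complex.exp (θ * Complex.I)‖ = r := by
  simp [Complex.norm_exp_ofReal_mul_I, abs_of_pos h]

theorem torusMean_indep_fst {G : ℂ × ℂ → ℂ} (hG : DifferentiableOn ℂ G punctured) {ρ ρ' t : ℝ}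
    (h0 : 0 < ρ) (h1 : ρ ≤ ρ') (h2 : ρ' < t) (h3 : t < 1) :
    torusMean G ρ' t = torusMean G ρ t := by
  have h0' := h0.trans_le h1
  have ht := h0'.trans h2
  rw [torusMean_swap, torusMean_swap]
  · congr 1
    refine intervalIntegral.integral_congr fun γ _ => ?_
    refine integral_circle_indep (h := fun z => G (z, t * Complex.exp (γ * Complex.I))) h0 h1 ?_
    intro z hz hz'
    have : DifferentiableAt ℂ G (z, t * Complex.exp (γ * Complex.I)) := by
      refine hG.differentiableAt (isOpen_punctured.mem_nhds ⟨⟨?_, ?_⟩, ?_⟩)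
      · simpa only [norm_mul_exp ht] using hz'.trans_lt h2
      · simpa only [norm_mul_exp ht]
      · exact norm_pos_iff.1 (h0.trans_le hz)
    exact this.comp z (f := fun z => (z, t * Complex.exp (γ * Complex.I))) (by fun_prop)
  · exact continuous_comp_torusPoint hG.continuousOn h0 (h1.trans_lt h2) h3
  · exact continuous_comp_torusPoint hG.continuousOn h0' h2 h3

theorem torusMean_indep_snd {G : ℂ × ℂ → ℂ} (hG : DifferentiableOn ℂ G punctured) {ρ t t' : ℝ}
    (h0 : 0 < ρ) (h1 : ρ < t) (h2 : t ≤ t') (h3 : t' < 1) :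
    torusMean G ρ t' = torusMean G ρ t := by
  unfold torusMean
  congr 1
  refine intervalIntegral.integral_congr fun θ _ => ?_
  refine integral_circle_indep (h := fun z => G (ρ * Complex.exp (θ * Complex.I), z))
    (h0.trans h1) h2 ?_
  intro z hz hz'
  have : DifferentiableAt ℂ G (ρ * Complex.exp (θ * Complex.I), z) := by
    refine hG.differentiableAt (isOpen_punctured.mem_nhds ⟨⟨?_, ?_⟩, ?_⟩)
    · simpa only [norm_mul_exp h0] using h1.trans_le hz
    · exact hz'.trans_lt h3
    · exact norm_pos_iff.1 (by simpa only [norm_mul_exp h0])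
  exact this.comp z (f := fun z => (ρ * Complex.exp (θ * Complex.I), z)) (by fun_prop)

theorem torusMean_indep {G : ℂ × ℂ → ℂ} (hG : DifferentiableOn ℂ G punctured) {ρ ρ' t t' : ℝ}
    (h0 : 0 < ρ) (h1 : ρ < t) (h2 : t < 1) (h0' : 0 < ρ') (h1' : ρ' < t') (h2' : t' < 1) :
    torusMean G ρ t = torusMean G ρ' t' := by
  have hm : max t t' < 1 := max_lt h2 h2'
  have hn : 0 < min ρ ρ' := lt_min h0 h0'
  rw [← torusMean_indep_snd hG h0 h1 (le_max_left t t') hm,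
    ← torusMean_indep_snd hG h0' h1' (le_max_right t t') hm,
    torusMean_indep_fst hG hn (min_le_left ρ ρ') (h1.trans_le (le_max_left _ _)) hm,
    torusMean_indep_fst hG hn (min_le_right ρ ρ') (h1'.trans_le (le_max_right _ _)) hm]

/-- The Laurent coefficient at `z^k w^l`, computed on the torus `|z| = ρ`, `|w| = t`. -/
def laurent (f : ℂ × ℂ → ℂ) (k l : ℤ) (ρ t : ℝ) : ℂ :=
  torusMean (fun p => p.1 ^ (-k) * p.2 ^ (-l) * f p) ρ t

theorem differentiableOn_laurent {f : ℂ × ℂ → ℂ} (hf : DifferentiableOn ℂ f hartogsTriangle)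
    (k l : ℤ) : DifferentiableOn ℂ (fun p : ℂ × ℂ => p.1 ^ k * p.2 ^ l * f p) punctured := by
  intro p hp
  have h2 : p.2 ≠ 0 := norm_pos_iff.1 ((norm_nonneg _).trans_lt hp.1.1)
  have h1 : p.1 ≠ 0 := hp.2
  have a1 : DifferentiableAt ℂ (fun p : ℂ × ℂ => p.1 ^ k) p :=
    (differentiableAt_zpow.2 (Or.inl h1)).comp p differentiableAt_fst
  have a2 : DifferentiableAt ℂ (fun p : ℂ × ℂ => p.2 ^ l) p :=
    (differentiableAt_zpow.2 (Or.inl h2)).comp p differentiableAt_snd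
  exact ((a1.mul a2).mul (hf.differentiableAt
    (isOpen_hartogsTriangle.mem_nhds hp.1))).differentiableWithinAt

theorem mFourierCoeff_eq {f : ℂ × ℂ → ℂ} (hf : ContinuousOn f hartogsTriangle) {ρ t : ℝ}
    (h0 : 0 < ρ) (h1 : ρ < t) (h2 : t < 1) (n : Fin 2 → ℤ) :
    UnitAddTorus.mFourierCoeff (fun x => f (torusPoint ρ t x)) n =
      ρ ^ (n 0) * t ^ (n 1) * laurent f (n 0) (n 1) ρ t := by
  have hρ : (ρ : ℂ) ≠ 0 := by exact_mod_cast h0.ne'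
  have ht : (t : ℂ) ≠ 0 := by exact_mod_cast (h0.trans h1).ne'
  unfold laurent
  rw [torusMean_eq, ← integral_const_mul]
  · change ∫ x, _ ∂torusMeasure = _
    refine integral_congr_ae (.of_forall fun x => ?_)
    simp only [UnitAddTorus.mFourier, ContinuousMap.coe_mk, Fin.prod_univ_two, torusPoint,
      fourier_apply, Pi.neg_apply, smul_eq_mul, mul_zpow, AddCircle.toCircle_zsmul,
      zpow_neg, Circle.coe_inv]
    rw [Circle.coe_zpow, Circle.coe_zpow]
    field_simp
  · refine continuous_comp_torusPoint
      (G := fun p : ℂ × ℂ => p.1 ^ (-n 0) * p.2 ^ (-n 1) * f p) (ContinuousOn.mul (ContinuousOn.mul ?_ ?_)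
      (hf.mono inter_subset_left)) h0 h1 h2
    · exact ContinuousOn.zpow₀ (by fun_prop) _ fun p hp => Or.inl hp.2
    · exact ContinuousOn.zpow₀ (by fun_prop) _ fun p hp =>
        Or.inl (norm_pos_iff.1 ((norm_nonneg _).trans_lt hp.1.1))

theorem hasSum_parseval {f : ℂ × ℂ → ℂ} (hf : ContinuousOn f hartogsTriangle) {ρ t : ℝ}
    (h0 : 0 < ρ) (h1 : ρ < t) (h2 : t < 1) :
    HasSum (fun n : Fin 2 → ℤ => ‖laurent f (n 0) (n 1) ρ t‖ ^ 2 * (ρ ^ (2 * n 0) * t ^ (2 * n 1)))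
      (torusMean (fun p => ‖f p‖ ^ 2) ρ t) := by
  have hc : Continuous fun x => f (torusPoint ρ t x) :=
    continuous_comp_torusPoint (hf.mono inter_subset_left) h0 h1 h2
  let g : C(UnitAddTorus (Fin 2), ℂ) := ⟨_, hc⟩
  have key := UnitAddTorus.hasSum_sq_mFourierCoeff (ContinuousMap.toLp 2 torusMeasure ℂ g)
  have e : ∀ n, UnitAddTorus.mFourierCoeff (ContinuousMap.toLp 2 torusMeasure ℂ g) n =
      UnitAddTorus.mFourierCoeff g n := UnitAddTorus.mFourierCoeff_toLp g
  simp only [e] at key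
  rw [torusMean_eq _ _ _ (hc.norm.pow 2)]
  convert key using 1
  · funext n
    have : UnitAddTorus.mFourierCoeff g n = _ := mFourierCoeff_eq hf h0 h1 h2 n
    rw [this]
    simp only [norm_mul, norm_zpow, Complex.norm_real, Real.norm_eq_abs, abs_of_pos h0,
      abs_of_pos (h0.trans h1)]
    rw [mul_comm 2 (n 0), mul_comm 2 (n 1), zpow_mul, zpow_mul, zpow_ofNat, zpow_ofNat]
    ring
  · refine integral_congr_ae ?_
    filter_upwards [ContinuousMap.coeFn_toLp (p := 2) (𝕜 := ℂ) torusMeasure g] with x hx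
    exact congrArg (fun z : ℂ => ‖z‖ ^ 2) hx.symm

theorem hardyMean_eq (f : ℂ × ℂ → ℂ) (s t : ℝ) :
    hardyMean f s t = torusMean (fun p => ‖f p‖ ^ 2) (s * t) t * (s * t ^ 2) := by
  simp only [hardyMean, torusMean, intervalIntegral.integral_mul_const, smul_eq_mul,
    Complex.ofReal_mul, mul_assoc]

theorem hardyMean_add_le {f g : ℂ × ℂ → ℂ} (hf : ContinuousOn f hartogsTriangle)
    (hg : ContinuousOn g hartogsTriangle) {s t : ℝ} (hs : s ∈ Ioo (0 : ℝ) 1)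
    (ht : t ∈ Ioo (0 : ℝ) 1) :
    hardyMean (f + g) s t ≤ 2 * (hardyMean f s t + hardyMean g s t) := by
  have h0 : 0 < s * t := mul_pos hs.1 ht.1
  have h1 : s * t < t := mul_lt_of_lt_one_left ht.1 hs.2
  have hc : ∀ f : ℂ × ℂ → ℂ, ContinuousOn f hartogsTriangle →
      Continuous fun x => ‖f (torusPoint (s * t) t x)‖ ^ 2 := fun f hf =>
    (continuous_comp_torusPoint (hf.mono inter_subset_left) h0 h1 ht.2).norm.pow 2
  have hi : ∀ f : ℂ × ℂ → ℂ, ContinuousOn f hartogsTriangle →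
      Integrable (fun x => ‖f (torusPoint (s * t) t x)‖ ^ 2) torusMeasure := fun f hf =>
    (hc f hf).integrable_of_hasCompactSupport (HasCompactSupport.of_compactSpace _)
  simp only [hardyMean_eq]
  rw [← add_mul, ← mul_assoc 2]
  refine mul_le_mul_of_nonneg_right ?_ (mul_nonneg hs.1.le (sq_nonneg t))
  rw [torusMean_eq _ _ _ (hc _ (hf.add hg)), torusMean_eq _ _ _ (hc _ hf),
    torusMean_eq _ _ _ (hc _ hg), ← integral_add (hi _ hf) (hi _ hg), ← integral_const_mul]
  refine integral_mono (hi _ (hf.add hg)) (((hi _ hf).add (hi _ hg)).const_mul 2) fun x => ?_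
  set a := f (torusPoint (s * t) t x)
  set b := g (torusPoint (s * t) t x)
  change ‖a + b‖ ^ 2 ≤ 2 * (‖a‖ ^ 2 + ‖b‖ ^ 2)
  nlinarith [norm_add_le a b, norm_nonneg (a + b), sq_nonneg (‖a‖ - ‖b‖), norm_nonneg a,
    norm_nonneg b]

theorem hardyMean_mul_le {f h : ℂ × ℂ → ℂ} (hf : ContinuousOn f hartogsTriangle)
    (hh : ContinuousOn h hartogsTriangle) (h1 : ∀ p ∈ hartogsTriangle, ‖h p‖ ≤ 1) {s t : ℝ}
    (hs : s ∈ Ioo (0 : ℝ) 1) (ht : t ∈ Ioo (0 : ℝ) 1) :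
    hardyMean (h * f) s t ≤ hardyMean f s t := by
  have h0 : 0 < s * t := mul_pos hs.1 ht.1
  have h2 : s * t < t := mul_lt_of_lt_one_left ht.1 hs.2
  have hc : ∀ f : ℂ × ℂ → ℂ, ContinuousOn f hartogsTriangle →
      Continuous fun x => ‖f (torusPoint (s * t) t x)‖ ^ 2 := fun f hf =>
    (continuous_comp_torusPoint (hf.mono inter_subset_left) h0 h2 ht.2).norm.pow 2
  have hi : ∀ f : ℂ × ℂ → ℂ, ContinuousOn f hartogsTriangle →
      Integrable (fun x => ‖f (torusPoint (s * t) t x)‖ ^ 2) torusMeasure := fun f hf =>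
    (hc f hf).integrable_of_hasCompactSupport (HasCompactSupport.of_compactSpace _)
  simp only [hardyMean_eq]
  refine mul_le_mul_of_nonneg_right ?_ (mul_nonneg hs.1.le (sq_nonneg t))
  rw [torusMean_eq _ _ _ (hc _ (hh.mul hf)), torusMean_eq _ _ _ (hc _ hf)]
  refine integral_mono (hi _ (hh.mul hf)) (hi _ hf) fun x => ?_
  have := h1 _ (torusPoint_mem h0 h2 ht.2 x)
  simp only [Pi.mul_apply, norm_mul]
  gcongr
  exact mul_le_of_le_one_left (norm_nonneg _) this

theorem hardyMean_smul (c : ℂ) (f : ℂ × ℂ → ℂ) (s t : ℝ) :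
    hardyMean (c • f) s t = ‖c‖ ^ 2 * hardyMean f s t := by
  simp only [hardyMean, Pi.smul_apply, smul_eq_mul, norm_mul, mul_pow, mul_assoc,
    intervalIntegral.integral_const_mul]
  ring

/-- The functions in `H²(△_H)`: the holomorphic functions on `△_H` whose means are bounded.  A
function on `△_H` is represented by its extension by zero to `ℂ × ℂ`, so that two elements are
equal if and only if they agree on `△_H`. -/
def hardyFunctions : Submodule ℂ (ℂ × ℂ → ℂ) where
  carrier := {f | DifferentiableOn ℂ f hartogsTriangle ∧ (∀ p ∉ hartogsTriangle, f p = 0) ∧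
    BddAbove (hardyMeans f)}
  zero_mem' := ⟨differentiableOn_const 0, fun _ _ => rfl, 0, by
    rintro _ ⟨s, -, t, -, rfl⟩
    simp [hardyMean]⟩
  add_mem' := by
    rintro f g ⟨hf, hf0, A, hA⟩ ⟨hg, hg0, B, hB⟩
    refine ⟨hf.add hg, fun p hp => by simp [hf0 p hp, hg0 p hp], 2 * (A + B), ?_⟩
    rintro _ ⟨s, hs, t, ht, rfl⟩
    have h1 := hA ⟨s, hs, t, ht, rfl⟩
    have h2 := hB ⟨s, hs, t, ht, rfl⟩
    have := hardyMean_add_le hf.continuousOn hg.continuousOn hs ht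
    linarith
  smul_mem' := by
    rintro c f ⟨hf, hf0, A, hA⟩
    refine ⟨hf.const_smul c, fun p hp => by simp [hf0 p hp], ‖c‖ ^ 2 * A, ?_⟩
    rintro _ ⟨s, hs, t, ht, rfl⟩
    rw [hardyMean_smul]
    exact mul_le_mul_of_nonneg_left (hA ⟨s, hs, t, ht, rfl⟩) (sq_nonneg _)

theorem laurent_eq {f : ℂ × ℂ → ℂ} (hf : DifferentiableOn ℂ f hartogsTriangle) (k l : ℤ)
    {ρ t ρ' t' : ℝ} (h0 : 0 < ρ) (h1 : ρ < t) (h2 : t < 1) (h0' : 0 < ρ') (h1' : ρ' < t')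
    (h2' : t' < 1) : laurent f k l ρ t = laurent f k l ρ' t' :=
  torusMean_indep (differentiableOn_laurent hf _ _) h0 h1 h2 h0' h1' h2'

/-- Laurent coefficients computed on a fixed torus. -/
def lc (f : ℂ × ℂ → ℂ) (n : Fin 2 → ℤ) : ℂ := laurent f (n 0) (n 1) (1 / 4) (1 / 2)

theorem hardyMean_hasSum_int {f : ℂ × ℂ → ℂ} (hf : DifferentiableOn ℂ f hartogsTriangle) {s t : ℝ}
    (hs : s ∈ Ioo (0 : ℝ) 1) (ht : t ∈ Ioo (0 : ℝ) 1) :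
    HasSum (fun n : Fin 2 → ℤ => ‖lc f n‖ ^ 2 * (s ^ (2 * n 0 + 1) * t ^ (2 * (n 0 + n 1 + 1))))
      (hardyMean f s t) := by
  have h0 : 0 < s * t := mul_pos hs.1 ht.1
  have h1 : s * t < t := mul_lt_of_lt_one_left ht.1 hs.2
  rw [hardyMean_eq]
  refine ((hasSum_parseval hf.continuousOn h0 h1 ht.2).mul_right (s * t ^ 2)).congr_fun fun n => ?_
  have e : lc f n = laurent f (n 0) (n 1) (s * t) t :=
    laurent_eq hf _ _ (by norm_num) (by norm_num) (by norm_num) h0 h1 ht.2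
  rw [e, mul_zpow, zpow_add_one₀ hs.1.ne', mul_add, mul_add, zpow_add₀ ht.1.ne', zpow_add₀ ht.1.ne', mul_one,
    zpow_ofNat]
  ring

theorem zpow_unbounded {c B : ℝ} (hc : 0 < c) {e : ℤ} (he : e < 0)
    (h : ∀ s ∈ Ioo (0 : ℝ) 1, c * s ^ e ≤ B) : False := by
  set s := c / (c + |B| + 1) with hs
  have hpos : 0 < c + |B| + 1 := by positivity
  have h0 : 0 < s := by positivity
  have h1 : s < 1 := (div_lt_one hpos).2 (by have := abs_nonneg B; linarith)
  have h2 := h s ⟨h0, h1⟩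
  have h3 : s ^ (-1 : ℤ) ≤ s ^ e := zpow_le_zpow_right_of_le_one₀ h0 h1.le (by lia)
  have h4 : c * s ^ (-1 : ℤ) = c + |B| + 1 := by
    rw [hs]; simp; field_simp
  have h5 := mul_le_mul_of_nonneg_left h3 hc.le
  have := le_abs_self B
  linarith

theorem lc_eq_zero {f : ℂ × ℂ → ℂ} (hf : f ∈ hardyFunctions) (n : Fin 2 → ℤ)
    (hn : n 0 < 0 ∨ n 0 + n 1 + 1 < 0) : lc f n = 0 := by
  obtain ⟨hd, -, B, hB⟩ := hf
  by_contra hne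
  have hpos : 0 < ‖lc f n‖ ^ 2 := by positivity
  have key : ∀ s ∈ Ioo (0 : ℝ) 1, ∀ t ∈ Ioo (0 : ℝ) 1,
      ‖lc f n‖ ^ 2 * (s ^ (2 * n 0 + 1) * t ^ (2 * (n 0 + n 1 + 1))) ≤ B := by
    intro s hs t ht
    refine le_trans ?_ (hB ⟨s, hs, t, ht, rfl⟩)
    refine le_hasSum (hardyMean_hasSum_int hd hs ht) n fun m _ => ?_
    have := hs.1
    have := ht.1
    positivity
  have hh : (1 / 2 : ℝ) ∈ Ioo (0 : ℝ) 1 := by norm_num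
  rcases hn with hn | hn
  · refine zpow_unbounded (c := ‖lc f n‖ ^ 2 * (1 / 2) ^ (2 * (n 0 + n 1 + 1))) (B := B)
      (by positivity) (e := 2 * n 0 + 1) (by lia) fun s hs => ?_
    refine le_trans (le_of_eq ?_) (key s hs _ hh)
    ring
  · refine zpow_unbounded (c := ‖lc f n‖ ^ 2 * (1 / 2) ^ (2 * n 0 + 1)) (B := B)
      (by positivity) (e := 2 * (n 0 + n 1 + 1)) (by lia) fun s hs => ?_
    refine le_trans (le_of_eq ?_) (key _ hh s hs)
    ring

/-- The exponents of `(1/w) (z/w)^m w^n = z^m w^(n-m-1)`. -/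
def idx (m : ℕ × ℕ) : Fin 2 → ℤ := ![m.1, m.2 - m.1 - 1]

theorem idx_injective : Function.Injective idx := by
  intro a b h
  have h0 := congrFun h 0
  have h1 := congrFun h 1
  simp [idx] at h0 h1
  ext <;> lia

/-- The coefficient of `f` at `(1/w) (z/w)^m w^n`. -/
def coeff (f : ℂ × ℂ → ℂ) (m : ℕ × ℕ) : ℂ := lc f (idx m)

theorem hardyMean_hasSum {f : ℂ × ℂ → ℂ} (hf : f ∈ hardyFunctions) {s t : ℝ}
    (hs : s ∈ Ioo (0 : ℝ) 1) (ht : t ∈ Ioo (0 : ℝ) 1) :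
    HasSum (fun m : ℕ × ℕ => ‖coeff f m‖ ^ 2 * (s ^ (2 * m.1 + 1) * t ^ (2 * m.2)))
      (hardyMean f s t) := by
  have := hardyMean_hasSum_int hf.1 hs ht
  rw [← idx_injective.hasSum_iff] at this
  · convert this using 2 with m
    have e1 : 2 * idx m 0 + 1 = ((2 * m.1 + 1 : ℕ) : ℤ) := by simp [idx]
    have e2 : 2 * (idx m 0 + idx m 1 + 1) = ((2 * m.2 : ℕ) : ℤ) := by
      simp [idx]; lia
    simp only [Function.comp_apply, e1, e2, zpow_natCast, coeff]
  · intro n hn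
    rw [lc_eq_zero hf n]
    · simp
    · by_contra! h
      refine hn ⟨((n 0).toNat, (n 0 + n 1 + 1).toNat), ?_⟩
      funext i
      fin_cases i <;> simp [idx] <;> lia

theorem sum_coeff_le {f : ℂ × ℂ → ℂ} (hf : f ∈ hardyFunctions) (F : Finset (ℕ × ℕ)) :
    ∑ m ∈ F, ‖coeff f m‖ ^ 2 ≤ sSup (hardyMeans f) := by
  have hlim : Filter.Tendsto (fun r : ℝ => ∑ m ∈ F, ‖coeff f m‖ ^ 2 *
      (r ^ (2 * m.1 + 1) * r ^ (2 * m.2))) (nhdsWithin 1 (Iio 1))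
      (nhds (∑ m ∈ F, ‖coeff f m‖ ^ 2 * (1 ^ (2 * m.1 + 1) * 1 ^ (2 * m.2)))) := by
    refine Filter.Tendsto.mono_left (Continuous.tendsto ?_ 1) nhdsWithin_le_nhds
    fun_prop
  simp only [one_pow, mul_one] at hlim
  refine le_of_tendsto hlim ?_
  filter_upwards [Ioo_mem_nhdsLT (zero_lt_one' ℝ)] with r hr
  refine le_trans ?_ (le_csSup hf.2.2 ⟨r, hr, r, hr, rfl⟩)
  have := hr.1
  exact sum_le_hasSum F (fun m _ => by positivity) (hardyMean_hasSum hf hr hr)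

theorem summable_coeff {f : ℂ × ℂ → ℂ} (hf : f ∈ hardyFunctions) :
    Summable fun m => ‖coeff f m‖ ^ 2 :=
  summable_of_sum_le (fun _ => by positivity) (sum_coeff_le hf)

theorem hardyMeans_nonempty (f : ℂ × ℂ → ℂ) : (hardyMeans f).Nonempty :=
  ⟨_, 1 / 2, by norm_num, 1 / 2, by norm_num, rfl⟩

theorem sSup_hardyMeans {f : ℂ × ℂ → ℂ} (hf : f ∈ hardyFunctions) :
    sSup (hardyMeans f) = ∑' m, ‖coeff f m‖ ^ 2 := by
  refine le_antisymm (csSup_le (hardyMeans_nonempty f) ?_) ?_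
  · rintro _ ⟨s, hs, t, ht, rfl⟩
    refine hasSum_le (fun m => ?_) (hardyMean_hasSum hf hs ht) (summable_coeff hf).hasSum
    have := hs.1
    have := ht.1
    refine mul_le_of_le_one_right (by positivity) (mul_le_one₀ ?_ (by positivity) ?_)
    · exact pow_le_one₀ hs.1.le hs.2.le
    · exact pow_le_one₀ ht.1.le ht.2.le
  · exact (summable_coeff hf).tsum_le_of_sum_le (sum_coeff_le hf)

theorem laurent_add {f g : ℂ × ℂ → ℂ} (hf : DifferentiableOn ℂ f hartogsTriangle)
    (hg : DifferentiableOn ℂ g hartogsTriangle) (n : Fin 2 → ℤ) :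
    lc (f + g) n = lc f n + lc g n := by
  have hc : ∀ {f : ℂ × ℂ → ℂ}, DifferentiableOn ℂ f hartogsTriangle → Continuous fun x =>
      (fun p : ℂ × ℂ => p.1 ^ (-n 0) * p.2 ^ (-n 1) * f p) (torusPoint (1 / 4) (1 / 2) x) :=
    fun hf => continuous_comp_torusPoint (differentiableOn_laurent hf (-n 0) (-n 1)).continuousOn
      (by norm_num) (by norm_num) (by norm_num)
  have hi := fun {f : ℂ × ℂ → ℂ} (hf : DifferentiableOn ℂ f hartogsTriangle) =>
    (hc hf).integrable_of_hasCompactSupport (μ := torusMeasure) (HasCompactSupport.of_compactSpace _)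
  unfold lc laurent
  rw [torusMean_eq _ _ _ (hc (hf.add hg)), torusMean_eq _ _ _ (hc hf), torusMean_eq _ _ _ (hc hg),
    ← integral_add (hi hf) (hi hg)]
  simp only [Pi.add_apply, mul_add]

theorem laurent_smul (c : ℂ) (f : ℂ × ℂ → ℂ) (n : Fin 2 → ℤ) : lc (c • f) n = c * lc f n := by
  unfold lc laurent torusMean
  simp only [Pi.smul_apply, smul_eq_mul, mul_left_comm _ c, intervalIntegral.integral_const_mul]
  rw [mul_smul_comm]

theorem eq_zero_of_coeff {f : ℂ × ℂ → ℂ} (hf : f ∈ hardyFunctions) (h : ∀ m, coeff f m = 0) :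
    f = 0 := by
  have hp : ∀ p ∈ punctured, f p = 0 := by
    rintro ⟨z, w⟩ ⟨⟨h1, h2⟩, h3⟩
    simp only at h1 h2
    have hz : 0 < ‖z‖ := norm_pos_iff.2 h3
    have hw : 0 < ‖w‖ := hz.trans h1
    have hs : ‖z‖ / ‖w‖ ∈ Ioo (0 : ℝ) 1 := ⟨by positivity, (div_lt_one hw).2 h1⟩
    have h0 := hardyMean_hasSum hf hs ⟨hw, h2⟩
    simp only [h, norm_zero, ne_eq, OfNat.ofNat_ne_zero, not_false_eq_true, zero_pow, zero_mul] at h0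
    have h4 := h0.unique hasSum_zero
    have hc : Continuous fun x => f (torusPoint ‖z‖ ‖w‖ x) :=
      continuous_comp_torusPoint (hf.1.continuousOn.mono inter_subset_left) hz h1 h2
    rw [hardyMean_eq, div_mul_cancel₀ _ hw.ne', torusMean_eq _ _ _ (hc.norm.pow 2)] at h4
    have h5 := (mul_eq_zero.1 h4).resolve_right (by positivity)
    rw [integral_eq_zero_iff_of_nonneg (fun x => sq_nonneg ‖f (torusPoint ‖z‖ ‖w‖ x)‖)
      ((hc.norm.pow 2).integrable_of_hasCompactSupport (HasCompactSupport.of_compactSpace _))] at h5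
    have h6 := (Continuous.ae_eq_iff_eq torusMeasure (hc.norm.pow 2) continuous_zero).1 h5
    have h7 := congrFun h6 ![↑(z.arg / (2 * Real.pi)), ↑(w.arg / (2 * Real.pi))]
    have hx : ∀ x : ℝ, ((AddCircle.toCircle (↑(x / (2 * Real.pi)) : UnitAddCircle) : Circle) : ℂ)
        = Complex.exp (x * Complex.I) := by
      intro x
      have hp : (Real.pi : ℂ) ≠ 0 := by exact_mod_cast Real.pi_ne_zero
      rw [AddCircle.toCircle_apply_mk, Circle.coe_exp]
      congr 2
      push_cast
      field_simp
    have h8 : torusPoint ‖z‖ ‖w‖ ![↑(z.arg / (2 * Real.pi)), ↑(w.arg / (2 * Real.pi))] = (z, w) := by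
      have e0 := hx z.arg
      have e1 := hx w.arg
      refine Prod.ext ?_ ?_
      · exact (congrArg _ e0).trans (Complex.norm_mul_exp_arg_mul_I z)
      · exact (congrArg _ e1).trans (Complex.norm_mul_exp_arg_mul_I w)
    change ‖f (torusPoint ‖z‖ ‖w‖ _)‖ ^ 2 = 0 at h7
    rw [h8] at h7
    simpa using h7
  funext ⟨z, w⟩
  by_cases hm : (z, w) ∈ hartogsTriangle
  swap
  · exact hf.2.1 _ hm
  by_cases hz : z = 0
  swap
  · exact hp _ ⟨hm, hz⟩
  subst hz
  have hc : ContinuousAt (fun z => f (z, w)) 0 :=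
    (hf.1.continuousOn.continuousAt (isOpen_hartogsTriangle.mem_nhds hm)).comp
      (f := fun z => (z, w)) (by fun_prop)
  have hU : {z | (z, w) ∈ hartogsTriangle} ∈ nhds (0 : ℂ) :=
    (isOpen_hartogsTriangle.preimage (by fun_prop : Continuous fun z : ℂ => (z, w))).mem_nhds hm
  refine tendsto_nhds_unique (hc.tendsto.mono_left nhdsWithin_le_nhds)
    (Filter.Tendsto.congr' ?_ (tendsto_const_nhds (f := nhdsWithin (0 : ℂ) {0}ᶜ)))
  filter_upwards [self_mem_nhdsWithin, nhdsWithin_le_nhds hU] with z h1 h2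
  exact (hp (z, w) ⟨h2, h1⟩).symm

/-- The Hardy space `H²(△_H)`, with the norm whose square is the supremum in its definition.  The
inner product is the one that induces this norm, given by polarization. -/
def HardySpace : Type := hardyFunctions

namespace HardySpace

instance : AddCommGroup HardySpace := inferInstanceAs (AddCommGroup hardyFunctions)
instance : Module ℂ HardySpace := inferInstanceAs (Module ℂ hardyFunctions)
instance : CoeFun HardySpace fun _ => ℂ × ℂ → ℂ := ⟨fun f => f.1⟩
instance : Norm HardySpace := ⟨fun f => √(sSup (hardyMeans f))⟩

theorem norm_def (f : HardySpace) : ‖f‖ = √(sSup (hardyMeans f)) := rfl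

theorem memℓp_coeff (f : HardySpace) : Memℓp (E := fun _ : ℕ × ℕ => ℂ) (coeff f) 2 :=
  memℓp_gen (by simpa using summable_coeff f.2)

/-- The coefficients with respect to the functions `(1/w) (z/w)^m w^n`, `m, n ≥ 0`. -/
def coeffs : HardySpace →ₗ[ℂ] lp (fun _ : ℕ × ℕ => ℂ) 2 where
  toFun f := ⟨coeff f, memℓp_coeff f⟩
  map_add' f g := by
    ext m
    exact laurent_add f.2.1 g.2.1 (idx m)
  map_smul' c f := by
    ext m
    exact laurent_smul c f (idx m)

theorem norm_coeffs (f : HardySpace) : ‖coeffs f‖ = ‖f‖ := by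
  rw [norm_def, sSup_hardyMeans f.2, lp.norm_eq_tsum_rpow (by norm_num)]
  simp [Real.sqrt_eq_rpow, coeffs]

theorem coeffs_injective : Function.Injective coeffs := by
  rw [injective_iff_map_eq_zero]
  intro f hf
  refine Subtype.ext (eq_zero_of_coeff f.2 fun m => ?_)
  exact congrFun (congrArg Subtype.val hf) m

theorem normedSpaceCore : NormedSpace.Core ℂ HardySpace where
  norm_nonneg f := Real.sqrt_nonneg _
  norm_smul c f := by rw [← norm_coeffs, map_smul, norm_smul, norm_coeffs]
  norm_triangle f g := by
    rw [← norm_coeffs, ← norm_coeffs, ← norm_coeffs, map_add]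
    exact norm_add_le _ _
  norm_eq_zero_iff f := by
    rw [← norm_coeffs, norm_eq_zero, map_eq_zero_iff _ coeffs_injective]

instance : NormedAddCommGroup HardySpace := NormedAddCommGroup.ofCore normedSpaceCore
instance : NormedSpace ℂ HardySpace := NormedSpace.ofCore normedSpaceCore
instance : InnerProductSpace ℂ HardySpace := InnerProductSpace.ofNorm ℂ fun f g => by
  have := parallelogram_law_with_norm ℂ (coeffs f) (coeffs g)
  rw [← map_add, ← map_sub, norm_coeffs, norm_coeffs, norm_coeffs, norm_coeffs] at this
  linarith

/-- `HardySpace.coeffs` as a linear isometry. -/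
def coeffsₗᵢ : HardySpace →ₗᵢ[ℂ] lp (fun _ : ℕ × ℕ => ℂ) 2 := ⟨coeffs, norm_coeffs⟩

end HardySpace

theorem differentiableOn_powerSeries {a : ℕ × ℕ → ℂ} {A : ℝ} (ha : ∀ m, ‖a m‖ ≤ A) :
    DifferentiableOn ℂ (fun p : ℂ × ℂ => ∑' m : ℕ × ℕ, a m * (p.1 ^ m.1 * p.2 ^ m.2))
      (Metric.ball 0 1) := by
  intro p hp
  rw [mem_ball_zero_iff] at hp
  obtain ⟨r, hpr, hr⟩ := exists_between hp
  have hr0 : 0 < r := (norm_nonneg p).trans_lt hpr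
  have hA : 0 ≤ A := (norm_nonneg _).trans (ha (0, 0))
  let f' : ℕ × ℕ → ℂ × ℂ → (ℂ × ℂ →L[ℂ] ℂ) := fun m x => a m •
    (x.1 ^ m.1 • ((m.2 * x.2 ^ (m.2 - 1)) • ContinuousLinearMap.snd ℂ ℂ ℂ) +
     x.2 ^ m.2 • ((m.1 * x.1 ^ (m.1 - 1)) • ContinuousLinearMap.fst ℂ ℂ ℂ))
  have s1 : Summable fun m : ℕ => r ^ m := summable_geometric_of_lt_one hr0.le hr
  have s2 : Summable fun m : ℕ => (m : ℝ) * r ^ (m - 1) := by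
    rw [← summable_nat_add_iff 1]
    simp only [Nat.cast_add, Nat.cast_one, add_tsub_cancel_right, add_mul, one_mul]
    refine Summable.add ?_ s1
    simpa using summable_pow_mul_geometric_of_norm_lt_one 1 (r := r) (by
      rwa [Real.norm_eq_abs, abs_of_pos hr0])
  have hu : Summable fun m : ℕ × ℕ => A * (r ^ m.1 * (m.2 * r ^ (m.2 - 1)) +
      (m.1 * r ^ (m.1 - 1)) * r ^ m.2) := by
    refine Summable.mul_left _ (Summable.add ?_ ?_)
    · exact s1.mul_of_nonneg s2 (fun _ => by positivity) (fun _ => by positivity)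
    · exact s2.mul_of_nonneg s1 (fun _ => by positivity) (fun _ => by positivity)
  have key := hasFDerivAt_tsum_of_isPreconnected (𝕜 := ℂ) (f' := f')
    (f := fun (m : ℕ × ℕ) (p : ℂ × ℂ) => a m * (p.1 ^ m.1 * p.2 ^ m.2)) hu
    (Metric.isOpen_ball (x := (0 : ℂ × ℂ)) (ε := r)) (convex_ball _ _).isPreconnected
    (fun m x _ => ?_) (fun m x hx => ?_) (Metric.mem_ball_self hr0) ?_ (mem_ball_zero_iff.2 hpr)
  · exact key.differentiableAt.differentiableWithinAt
  · have h1 : HasFDerivAt (fun x : ℂ × ℂ => x.1 ^ m.1) ((m.1 * x.1 ^ (m.1 - 1)) •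
      ContinuousLinearMap.fst ℂ ℂ ℂ) x :=
      (hasDerivAt_pow m.1 x.1).comp_hasFDerivAt x hasFDerivAt_fst
    have h2 : HasFDerivAt (fun x : ℂ × ℂ => x.2 ^ m.2) ((m.2 * x.2 ^ (m.2 - 1)) •
      ContinuousLinearMap.snd ℂ ℂ ℂ) x :=
      (hasDerivAt_pow m.2 x.2).comp_hasFDerivAt x hasFDerivAt_snd
    exact (h1.mul h2).const_mul (a m)
  · rw [mem_ball_zero_iff] at hx
    have hx1 : ‖x.1‖ ≤ r := (norm_fst_le x).trans hx.le
    have hx2 : ‖x.2‖ ≤ r := (norm_snd_le x).trans hx.le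
    have hf := ContinuousLinearMap.norm_fst_le ℂ ℂ ℂ
    have hs := ContinuousLinearMap.norm_snd_le ℂ ℂ ℂ
    simp only [f', norm_smul]
    refine mul_le_mul (ha m) ?_ (norm_nonneg _) hA
    refine (norm_add_le _ _).trans ?_
    simp only [norm_smul, norm_mul, norm_pow, Complex.norm_natCast]
    refine add_le_add ?_ ?_
    · calc _ ≤ r ^ m.1 * ((m.2 * r ^ (m.2 - 1)) * 1) := by gcongr
        _ = _ := by ring
    · calc _ ≤ r ^ m.2 * ((m.1 * r ^ (m.1 - 1)) * 1) := by gcongr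
        _ = _ := by ring
  · refine summable_of_ne_finset_zero (s := {(0, 0)}) fun m hm => ?_
    rcases m with ⟨_ | i, _ | j⟩ <;> simp at hm ⊢

open Classical in
/-- The function `∑ a_{m,n} (1/w) (z/w)^m w^n` on `△_H`, extended by zero. -/
def series (a : ℕ × ℕ → ℂ) (p : ℂ × ℂ) : ℂ :=
  if p ∈ hartogsTriangle then
    p.2⁻¹ * ∑' m : ℕ × ℕ, a m * ((p.1 / p.2) ^ m.1 * p.2 ^ m.2) else 0

theorem snd_ne_zero {p : ℂ × ℂ} (hp : p ∈ hartogsTriangle) : p.2 ≠ 0 :=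
  norm_pos_iff.1 ((norm_nonneg _).trans_lt hp.1)

theorem differentiableOn_series {a : ℕ × ℕ → ℂ} {A : ℝ} (ha : ∀ m, ‖a m‖ ≤ A) :
    DifferentiableOn ℂ (series a) hartogsTriangle := by
  have h1 : DifferentiableOn ℂ (fun p : ℂ × ℂ => (p.1 / p.2, p.2)) hartogsTriangle := fun p hp =>
    by
      have := (differentiableAt_snd (𝕜 := ℂ) (p := p)).fun_inv (snd_ne_zero hp)
      simp only [div_eq_mul_inv]
      exact ((differentiableAt_fst.fun_mul this).prodMk differentiableAt_snd).differentiableWithinAt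
  have h2 := (differentiableOn_powerSeries ha).comp h1 fun p hp => by
    rw [mem_ball_zero_iff, Prod.norm_def, max_lt_iff, norm_div]
    exact ⟨(div_lt_one (norm_pos_iff.2 (snd_ne_zero hp))).2 hp.1, hp.2⟩
  have h3 : DifferentiableOn ℂ (fun p : ℂ × ℂ => p.2⁻¹) hartogsTriangle := fun p hp =>
    (differentiableAt_snd.fun_inv (snd_ne_zero hp)).differentiableWithinAt
  exact (h3.mul h2).congr fun p hp => if_pos hp

theorem lc_series {a : ℕ × ℕ → ℂ} {A : ℝ} (ha : ∀ m, ‖a m‖ ≤ A) (n : Fin 2 → ℤ) :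
    HasSum (fun m => if idx m = n then a m else 0) (lc (series a) n) := by
  set ρ : ℝ := 1 / 4
  set t : ℝ := 1 / 2
  have h0 : 0 < ρ := by norm_num [ρ]
  have h1 : ρ < t := by norm_num [ρ, t]
  have h2 : t < 1 := by norm_num [t]
  have ht : 0 < t := h0.trans h1
  have hd := differentiableOn_series ha
  have hc : Continuous fun x => series a (torusPoint ρ t x) :=
    continuous_comp_torusPoint (hd.continuousOn.mono inter_subset_left) h0 h1 h2
  let g : C(UnitAddTorus (Fin 2), ℂ) := ⟨_, hc⟩
  let c : ℕ × ℕ → ℂ := fun m => a m * ((ρ : ℂ) ^ (idx m 0) * (t : ℂ) ^ (idx m 1))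
  have hA : 0 ≤ A := (norm_nonneg _).trans (ha (0, 0))
  have hcn : Summable fun m => ‖c m‖ := by
    have s1 : Summable fun m : ℕ => (1 / 2 : ℝ) ^ m := summable_geometric_two
    refine Summable.of_norm_bounded
      ((s1.mul_of_nonneg s1 (fun _ => by positivity) (fun _ => by positivity)).mul_left (A * 2))
      fun m => ?_
    rw [norm_norm, norm_mul, mul_assoc]
    refine mul_le_mul (ha m) (le_of_eq ?_) (norm_nonneg _) hA
    simp only [idx, Matrix.cons_val_zero, Matrix.cons_val_one, norm_mul, norm_zpow,
      Complex.norm_real, Real.norm_eq_abs, abs_of_pos h0, abs_of_pos ht]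
    rw [zpow_sub₀ ht.ne', zpow_sub₀ ht.ne', zpow_natCast, zpow_natCast, zpow_natCast, zpow_one]
    have : ρ = t * t := by norm_num [ρ, t]
    rw [this, mul_pow]
    simp only [t]
    field_simp
  have hcs : Summable fun m => c m • UnitAddTorus.mFourier (idx m) :=
    .of_norm (by simpa only [norm_smul, UnitAddTorus.mFourier_norm, mul_one] using hcn)
  have hg : HasSum (fun m => c m • UnitAddTorus.mFourier (idx m)) g := by
    convert hcs.hasSum
    ext x
    have e1 := ((ContinuousMap.evalCLM ℂ x).hasSum hcs.hasSum).tsum_eq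
    have hx := torusPoint_mem h0 h1 h2 x
    have hρ' : (ρ : ℂ) ≠ 0 := by exact_mod_cast h0.ne'
    have ht' : (t : ℂ) ≠ 0 := by exact_mod_cast ht.ne'
    refine Eq.trans ?_ e1
    change series a _ = _
    rw [series, if_pos hx, ← tsum_mul_left]
    refine tsum_congr fun m => ?_
    change _ = c m • UnitAddTorus.mFourier (idx m) x
    have u0 := Circle.coe_ne_zero (AddCircle.toCircle (x 0))
    have u1 := Circle.coe_ne_zero (AddCircle.toCircle (x 1))
    simp only [UnitAddTorus.mFourier, ContinuousMap.coe_mk, Fin.prod_univ_two, torusPoint,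
      fourier_apply, smul_eq_mul, AddCircle.toCircle_zsmul, c, idx, Matrix.cons_val_zero,
      Matrix.cons_val_one]
    rw [Circle.coe_zpow, Circle.coe_zpow, zpow_sub₀ ht', zpow_sub₀ ht', zpow_sub₀ u1, zpow_sub₀ u1]
    simp only [zpow_natCast, zpow_one, mul_pow, div_pow]
    field_simp
  have hδ : ∀ j : Fin 2 → ℤ, ∫ x, UnitAddTorus.mFourier (-n) x • UnitAddTorus.mFourier j x
      ∂torusMeasure = if j = n then 1 else 0 := by
    intro j
    have e1 := UnitAddTorus.mFourierBasis_repr (UnitAddTorus.mFourierBasis j) n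
    rw [HilbertBasis.repr_self, UnitAddTorus.coe_mFourierBasis] at e1
    have e2 := (UnitAddTorus.mFourierCoeff_toLp (UnitAddTorus.mFourier j) n).symm.trans e1.symm
    refine Eq.trans e2 ?_
    rw [lp.single_apply]
    simp [Pi.single_apply, eq_comm]
  have hI := hasSum_integral_of_summable_integral_norm (μ := torusMeasure)
    (F := fun m x => UnitAddTorus.mFourier (-n) x • c m • UnitAddTorus.mFourier (idx m) x)
    (fun m => (by fun_prop : Continuous fun x => UnitAddTorus.mFourier (-n) x • c m •
      UnitAddTorus.mFourier (idx m) x).integrable_of_hasCompactSupport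
        (HasCompactSupport.of_compactSpace _)) (by
    have hn : ∀ (j : Fin 2 → ℤ) x, ‖UnitAddTorus.mFourier j x‖ = 1 := fun j x => by
      simp only [UnitAddTorus.mFourier, ContinuousMap.coe_mk, Fin.prod_univ_two, fourier_apply,
        norm_mul]
      exact (congrArg₂ (· * ·) (Circle.norm_coe _) (Circle.norm_coe _)).trans (one_mul 1)
    simpa [norm_smul, hn] using hcn)
  have hI2 : ∫ x, ∑' m, UnitAddTorus.mFourier (-n) x • c m • UnitAddTorus.mFourier (idx m) x
      ∂torusMeasure = ρ ^ (n 0) * t ^ (n 1) * lc (series a) n := by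
    refine Eq.trans (integral_congr_ae (.of_forall fun x => ?_))
      (mFourierCoeff_eq hd.continuousOn h0 h1 h2 n)
    have e1 := ((ContinuousMap.evalCLM ℂ x).hasSum hg).tsum_eq
    simp only [smul_eq_mul]
    rw [tsum_mul_left]
    exact congrArg _ e1
  rw [hI2] at hI
  have hne : (ρ : ℂ) ^ (n 0) * (t : ℂ) ^ (n 1) ≠ 0 := mul_ne_zero
    (zpow_ne_zero _ (by exact_mod_cast h0.ne')) (zpow_ne_zero _ (by exact_mod_cast ht.ne'))
  have hJ := hI.mul_left ((ρ : ℂ) ^ (n 0) * (t : ℂ) ^ (n 1))⁻¹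
  rw [inv_mul_cancel_left₀ hne] at hJ
  refine hJ.congr_fun fun m => ?_
  simp only [smul_comm _ (c m), integral_smul, hδ]
  split_ifs with h
  · subst h
    simp only [c, smul_eq_mul]
    rw [mul_one, mul_comm (a m), inv_mul_cancel_left₀ hne]
  · simp

theorem coeff_series_idx {a : ℕ × ℕ → ℂ} {A : ℝ} (ha : ∀ m, ‖a m‖ ≤ A) (m : ℕ × ℕ) :
    coeff (series a) m = a m := by
  refine (lc_series ha (idx m)).unique ?_
  simpa using hasSum_single (f := fun m' => if idx m' = idx m then a m' else 0) m
    fun m' hm => if_neg fun h => hm (idx_injective h)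

theorem series_mem {a : ℕ × ℕ → ℂ} (ha : Summable fun m => ‖a m‖ ^ 2) :
    series a ∈ hardyFunctions := by
  have hb : ∀ m, ‖a m‖ ≤ √(∑' m, ‖a m‖ ^ 2) := fun m =>
    Real.le_sqrt_of_sq_le (ha.le_tsum m fun _ _ => by positivity)
  refine ⟨differentiableOn_series hb, fun p hp => if_neg hp, ∑' m, ‖a m‖ ^ 2, ?_⟩
  rintro _ ⟨s, hs, t, ht, rfl⟩
  have h := hardyMean_hasSum_int (differentiableOn_series hb) hs ht
  rw [← idx_injective.hasSum_iff] at h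
  · refine hasSum_le (fun m => ?_) h ha.hasSum
    have e1 : 2 * idx m 0 + 1 = ((2 * m.1 + 1 : ℕ) : ℤ) := by simp [idx]
    have e2 : 2 * (idx m 0 + idx m 1 + 1) = ((2 * m.2 : ℕ) : ℤ) := by
      simp [idx]; lia
    have e3 : lc (series a) (idx m) = a m := coeff_series_idx hb m
    simp only [Function.comp_apply, e1, e2, zpow_natCast, e3]
    have := hs.1
    have := ht.1
    refine mul_le_of_le_one_right (by positivity) (mul_le_one₀ ?_ (by positivity) ?_)
    · exact pow_le_one₀ hs.1.le hs.2.le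
    · exact pow_le_one₀ ht.1.le ht.2.le
  · intro n hn
    have : lc (series a) n = 0 := (lc_series hb n).unique (by
      convert hasSum_zero with m
      exact if_neg fun h => hn ⟨m, h⟩)
    simp [this]

namespace HardySpace

theorem coeffs_surjective : Function.Surjective coeffs := by
  intro a
  have ha : Summable fun m => ‖a m‖ ^ 2 := by
    simpa using (lp.memℓp a).summable (by norm_num)
  refine ⟨⟨series a, series_mem ha⟩, ?_⟩
  ext m
  exact coeff_series_idx (lp.norm_apply_le_norm (by norm_num) a) m

/-- `H²(△_H)` is isometrically isomorphic to `ℓ²(ℕ × ℕ)`. -/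
def coeffsEquiv : HardySpace ≃ₗᵢ[ℂ] lp (fun _ : ℕ × ℕ => ℂ) 2 :=
  LinearIsometryEquiv.ofSurjective coeffsₗᵢ coeffs_surjective

instance : CompleteSpace HardySpace :=
  coeffsEquiv.toIsometryEquiv.completeSpace

theorem mul_mem {h : ℂ × ℂ → ℂ} (hd : Differentiable ℂ h)
    (h1 : ∀ p ∈ hartogsTriangle, ‖h p‖ ≤ 1) (f : HardySpace) :
    h * f.1 ∈ hardyFunctions ∧ sSup (hardyMeans (h * f.1)) ≤ sSup (hardyMeans f.1) := by
  have key : ∀ x ∈ hardyMeans (h * f.1), x ≤ sSup (hardyMeans f.1) := by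
    rintro _ ⟨s, hs, t, ht, rfl⟩
    exact (hardyMean_mul_le f.2.1.continuousOn hd.continuous.continuousOn h1 hs ht).trans
      (le_csSup f.2.2.2 ⟨s, hs, t, ht, rfl⟩)
  refine ⟨⟨hd.differentiableOn.mul f.2.1, fun p hp => ?_, _, key⟩,
    csSup_le (hardyMeans_nonempty _) key⟩
  simp [f.2.2.1 p hp]

/-- Multiplication by an entire function `h` with `|h| ≤ 1` on `△_H`. -/
def mulOp (h : ℂ × ℂ → ℂ) (hd : Differentiable ℂ h)
    (h1 : ∀ p ∈ hartogsTriangle, ‖h p‖ ≤ 1) : HardySpace →L[ℂ] HardySpace :=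
  LinearMap.mkContinuous
    { toFun := fun f => ⟨h * f.1, (mul_mem hd h1 f).1⟩
      map_add' := fun f g => Subtype.ext (mul_add h f.1 g.1)
      map_smul' := fun c f => Subtype.ext (mul_smul_comm c h f.1) } 1
    fun f => by
      rw [one_mul]
      exact Real.sqrt_le_sqrt (mul_mem hd h1 f).2

/-- `M_z`, multiplication by the first coordinate. -/
def Mz : HardySpace →L[ℂ] HardySpace :=
  mulOp Prod.fst differentiable_fst fun _ hp => (hp.1.trans hp.2).le

/-- `M_w`, multiplication by the second coordinate. -/
def Mw : HardySpace →L[ℂ] HardySpace :=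
  mulOp Prod.snd differentiable_snd fun _ hp => hp.2.le

theorem Mz_apply (f : HardySpace) (p : ℂ × ℂ) : Mz f p = p.1 * f p := rfl

theorem Mw_apply (f : HardySpace) (p : ℂ × ℂ) : Mw f p = p.2 * f p := rfl

end HardySpace

/-- The closed linear span `[E]_T` of `{T₁ ^ k₁ T₂ ^ k₂ e | e ∈ E, k₁, k₂ ≥ 0}`. -/
def closedSpan {H : Type*} [NormedAddCommGroup H] [InnerProductSpace ℂ H]
    (T₁ T₂ : H →L[ℂ] H) (E : Set H) : Submodule ℂ H :=
  (Submodule.span ℂ {x | ∃ k₁ k₂ : ℕ, ∃ e ∈ E, x = (T₁ ^ k₁) ((T₂ ^ k₂) e)}).topologicalClosure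

/-- The rank of a pair of operators: the least number of elements of a set `E` with `[E]_T = H`
(`⊤ : ℕ∞` if there is no finite such set; the set of cardinalities below is never empty, since
`E = H` is admissible, and the infimum in `ℕ∞` is a minimum). -/
def rank {H : Type*} [NormedAddCommGroup H] [InnerProductSpace ℂ H] (T₁ T₂ : H →L[ℂ] H) : ℕ∞ :=
  sInf {n | ∃ E : Set H, closedSpan T₁ T₂ E = ⊤ ∧ E.encard = n}

/-- A submodule of the Hilbert module `H²(△_H)` over `ℂ[z, w]`: a closed linear subspace invariant
under multiplication by `z` and by `w`. -/
structure HardySubmodule where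
  /-- the underlying linear subspace -/
  carrier : Submodule ℂ HardySpace
  isClosed : IsClosed (carrier : Set HardySpace)
  Mz_mem : ∀ f ∈ carrier, HardySpace.Mz f ∈ carrier
  Mw_mem : ∀ f ∈ carrier, HardySpace.Mw f ∈ carrier

namespace HardySubmodule

instance (S : HardySubmodule) : CompleteSpace S.carrier := S.isClosed.completeSpace_coe

/-- `S_z`, the restriction of `M_z` to `S`. -/
def Sz (S : HardySubmodule) : S.carrier →L[ℂ] S.carrier := HardySpace.Mz.restrict S.Mz_mem

/-- `S_w`, the restriction of `M_w` to `S`. -/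
def Sw (S : HardySubmodule) : S.carrier →L[ℂ] S.carrier := HardySpace.Mw.restrict S.Mw_mem

/-- `S` is doubly commuting if `S_z^* S_w - S_w S_z^* = 0`; the adjoint is taken in the Hilbert
space `S`. -/
def DoublyCommuting (S : HardySubmodule) : Prop :=
  (ContinuousLinearMap.adjoint S.Sz).comp S.Sw - S.Sw.comp (ContinuousLinearMap.adjoint S.Sz) = 0

end HardySubmodule

end Hartogs

end

/-! The coefficients with respect to `(1/w) (z/w)^m w^n` identify `H²(△_H)` with `ℓ²(ℕ × ℕ)`. Under
this identification `M_w` is the shift by `(0, 1)` and, since `z = (z/w) w`, `M_z` is the shift by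
`(1, 1)`. So `S_z` and `S_w` are commuting isometries, and they are pure because high powers push
every coefficient to zero.

For doubly commuting pure isometries `A`, `B`, a Wold argument (`eq_zero_of_orthogonal_wandering`)
shows that the vectors `A^i B^j v` with `v` in the wandering space `W = ker A* ∩ ker B*` span a
dense subspace. In particular `W ≠ 0` when `S ≠ 0`, and it remains to see that `dim W ≤ 1`: then any
nonzero `g ∈ W` is cyclic (`closedSpan_eq_top`), and the rank is `1` because the empty set spans
only `0`.

The bound on `dim W` comes from the commutativity of convolution (`not_orthogonal_shifts`). Let `f,
g ∈ W` be orthogonal unit vectors. All shifts of `f` and of `g` by elements of `ℕ × ℕ` form one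
orthonormal system (`inner_shift_eq_zero`). The series `∑ gₙ shiftₙ f` and `∑ fₙ shiftₙ g` converge
in `ℓ²` and have the same coefficients, those of the convolution of `f` and `g`. Their common value
lies in two orthogonal closed subspaces, so it is `0`. Orthonormality of the shifts of `f` then
gives `g = 0`, a contradiction. -/

noncomputable section
namespace Hartogs

/-! ### Wold decomposition for a doubly commuting pair of pure isometries. -/

section Wold

theorem clm_mul_apply {H : Type*} [NormedAddCommGroup H] [InnerProductSpace ℂ H]
    (S T : H →L[ℂ] H) (x : H) : (S * T) x = S (T x) := rfl

variable {H : Type*} [NormedAddCommGroup H] [InnerProductSpace ℂ H] [CompleteSpace H]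
  {A B : H →L[ℂ] H}

open ContinuousLinearMap

theorem inner_pow_apply_of_isometry (hA : star A * A = 1) (n : ℕ) (x y : H) :
    inner ℂ ((A ^ n) x) ((A ^ n) y) = inner ℂ x y := by
  induction n with
  | zero => simp
  | succ n ih =>
    rw [pow_succ', clm_mul_apply, clm_mul_apply, ← adjoint_inner_right, ← star_eq_adjoint,
      ← clm_mul_apply, hA, one_apply_eq_self, ih]

/-- If `A` is pure and `1 - A A*` kills all the vectors `A*ⁿ x`, then `x = 0`. -/
theorem eq_zero_of_forall_defect (hp : ∀ x, (∀ n : ℕ, ∃ y, x = (A ^ n) y) → x = 0) {x : H}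
    (h : ∀ n : ℕ, (star A ^ n) x - A (star A ((star A ^ n) x)) = 0) : x = 0 := by
  refine hp x fun n => ⟨(star A ^ n) x, ?_⟩
  induction n with
  | zero => simp
  | succ n ih =>
    -- The vanishing defect says `A*ⁿ x = A A*ⁿ⁺¹ x`, so `x = Aⁿ A*ⁿ x` passes from `n` to `n + 1`.
    rw [pow_succ, pow_succ', clm_mul_apply, clm_mul_apply, ← sub_eq_zero.1 (h n), ← ih]

/-- `P = 1 - A A*` and `Q = 1 - B B*` are the projections onto `ker A*` and `ker B*`. Double
commutativity makes them commute, so `P Q` projects onto the wandering space, and the orthogonality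
hypothesis becomes `P Q B*^j A*^i x = 0` for all `i, j`. Purity of `B` removes `Q`, then purity of
`A` removes `P`. -/
theorem eq_zero_of_orthogonal_wandering (hA : star A * A = 1) (hB : star B * B = 1)
    (hAB : Commute A B) (hdc : Commute (star A) B)
    (hpA : ∀ x, (∀ n : ℕ, ∃ y, x = (A ^ n) y) → x = 0)
    (hpB : ∀ x, (∀ n : ℕ, ∃ y, x = (B ^ n) y) → x = 0) {x : H}
    (h : ∀ i j : ℕ, ∀ v, star A v = 0 → star B v = 0 → inner ℂ ((A ^ i) ((B ^ j) v)) x = 0) :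
    x = 0 := by
  have hdc' : Commute A (star B) := by simpa using hdc.star_star
  have hAB' : Commute (star A) (star B) := hAB.star_star
  set P := 1 - A * star A with hP
  set Q := 1 - B * star B with hQ
  have hAP : star A * P = 0 := by rw [hP, mul_sub, ← mul_assoc, hA]; simp
  have hBQ : star B * Q = 0 := by rw [hQ, mul_sub, ← mul_assoc, hB]; simp
  have cPB : Commute P (star B) :=
    (Commute.one_left _).sub_left (hdc'.mul_left hAB')
  have cPB' : Commute P B := (Commute.one_left _).sub_left (hAB.mul_left hdc)
  have cPQ : Commute P Q := (Commute.one_right _).sub_right (cPB'.mul_right cPB)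
  have sP : star P = P := by simp [hP]
  have sQ : star Q = Q := by simp [hQ]
  have hPP : P * P = P := by
    nth_rw 1 [hP]; rw [sub_mul, mul_assoc, hAP]; simp
  have hQQ : Q * Q = Q := by
    nth_rw 1 [hQ]; rw [sub_mul, mul_assoc, hBQ]; simp
  have key : ∀ i j : ℕ, (P * Q) ((star B ^ j) ((star A ^ i) x)) = 0 := by
    intro i j
    set y := (star B ^ j) ((star A ^ i) x) with hy
    have h1 : star A ((P * Q) y) = 0 := by
      rw [← clm_mul_apply, ← mul_assoc, hAP, zero_mul, zero_apply]
    have h2 : star B ((P * Q) y) = 0 := by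
      rw [← clm_mul_apply, cPQ.eq, ← mul_assoc, hBQ, zero_mul, zero_apply]
    -- `P Q y` is itself wandering, so it may be used as the test vector. Moving `A^i B^j` across
    -- gives `⟨P Q y, y⟩ = 0`, and this is `‖P Q y‖²`.
    have h3 := h i j _ h1 h2
    rw [← adjoint_inner_right, ← adjoint_inner_right, ← star_eq_adjoint, ← star_eq_adjoint,
      star_pow, star_pow, ← hy] at h3
    have h4 : P * Q * (P * Q) = P * Q := by
      rw [mul_assoc, ← mul_assoc Q, ← cPQ.eq, mul_assoc, hQQ, ← mul_assoc, hPP]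
    have h5 : star (P * Q) = P * Q := by rw [star_mul, sP, sQ, cPQ.eq]
    rw [← inner_self_eq_zero (𝕜 := ℂ), ← adjoint_inner_right, ← star_eq_adjoint, h5,
      ← clm_mul_apply, h4, ← inner_conj_symm, h3, map_zero]
  refine eq_zero_of_forall_defect hpA fun i => ?_
  set y := (star A ^ i) x
  have hPy : P y = y - A (star A y) := by simp [hP]
  rw [← hPy]
  refine eq_zero_of_forall_defect hpB fun j => ?_
  -- `P` commutes with `B*` and `Q`, so it can be moved to the outside, which is the form of `key`.
  have e : Q ((star B ^ j) (P y)) = 0 := by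
    rw [← clm_mul_apply (star B ^ j), ← (cPB.pow_right j).eq, clm_mul_apply, ← clm_mul_apply Q,
      ← cPQ.eq]
    exact key i j
  simpa [hQ] using e

/-- After cancelling `A^k`, at least one `A` is left on the side of `f`. Moved across as `A*`, it
passes through `B^l` by double commutativity and kills `g`. -/
theorem inner_pow_pow_eq_zero_of_lt (hA : star A * A = 1)
    (hdc : Commute (star A) B) {f g : H} (hg : star A g = 0) {i k : ℕ} (hik : k < i) (j l : ℕ) :
    inner ℂ ((A ^ i) ((B ^ j) f)) ((A ^ k) ((B ^ l) g)) = 0 := by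
  obtain ⟨d, rfl⟩ := Nat.exists_eq_add_of_lt hik
  rw [add_assoc, pow_add, clm_mul_apply, inner_pow_apply_of_isometry hA, pow_succ', clm_mul_apply,
    ← adjoint_inner_right, ← star_eq_adjoint, ← clm_mul_apply (star A), (hdc.pow_right l).eq,
    clm_mul_apply, hg, map_zero, inner_zero_right]

/-- If the exponents of `A` agree, those of `B` differ. Taking adjoints in the double commutation
relation lets `A` and `B` exchange roles. -/
theorem inner_pow_pow_eq_zero (hA : star A * A = 1) (hB : star B * B = 1)
    (hAB : Commute A B) (hdc : Commute (star A) B) {f g : H} (hfA : star A f = 0)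
    (hfB : star B f = 0) (hgA : star A g = 0) (hgB : star B g = 0) {i j k l : ℕ}
    (hne : ¬ (i = k ∧ j = l)) :
    inner ℂ ((A ^ i) ((B ^ j) f)) ((A ^ k) ((B ^ l) g)) = 0 := by
  have hdc' : Commute (star B) A := by simpa using hdc.star_star.symm
  have swap : ∀ (a b : ℕ) (v : H), (A ^ a) ((B ^ b) v) = (B ^ b) ((A ^ a) v) := fun a b v => by
    rw [← clm_mul_apply, (hAB.pow_pow a b).eq, clm_mul_apply]
  rcases lt_trichotomy i k with h | h | h
  · rw [← inner_conj_symm, inner_pow_pow_eq_zero_of_lt hA hdc hfA h, map_zero]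
  · rw [swap, swap]
    rcases lt_trichotomy j l with h' | h' | h'
    · rw [← inner_conj_symm, inner_pow_pow_eq_zero_of_lt hB hdc' hfB h', map_zero]
    · exact absurd ⟨h, h'⟩ hne
    · exact inner_pow_pow_eq_zero_of_lt hB hdc' hgB h' _ _
  · exact inner_pow_pow_eq_zero_of_lt hA hdc hgA h _ _

end Wold
theorem inner_smul_smul_eq_zero {H : Type*} [NormedAddCommGroup H] [InnerProductSpace ℂ H]
    {x y : H} (h : inner ℂ x y = 0) (a b : ℂ) : inner ℂ (a • x) (b • y) = 0 := by
  rw [inner_smul_left, inner_smul_right, h, mul_zero, mul_zero]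

/-- A vector that spans the common wandering space generates the whole space. -/
theorem closedSpan_eq_top {H : Type*} [NormedAddCommGroup H] [InnerProductSpace ℂ H]
    [CompleteSpace H] {A B : H →L[ℂ] H} (hA : star A * A = 1) (hB : star B * B = 1)
    (hAB : Commute A B) (hdc : Commute (star A) B)
    (hpA : ∀ x, (∀ n : ℕ, ∃ y, x = (A ^ n) y) → x = 0)
    (hpB : ∀ x, (∀ n : ℕ, ∃ y, x = (B ^ n) y) → x = 0) {g : H} (hgA : star A g = 0)
    (hgB : star B g = 0) (hg : g ≠ 0)
    (huniq : ∀ v, star A v = 0 → star B v = 0 → inner ℂ v g = 0 → v = 0) :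
    closedSpan A B {g} = ⊤ := by
  rw [closedSpan, Submodule.topologicalClosure_eq_top_iff, Submodule.eq_bot_iff]
  intro x hx
  refine eq_zero_of_orthogonal_wandering hA hB hAB hdc hpA hpB fun i j v hvA hvB => ?_
  have hgg : inner ℂ g g ≠ 0 := inner_self_ne_zero.2 hg
  set c : ℂ := inner ℂ g v / inner ℂ g g
  -- Subtracting from `v` its component along `g` leaves a wandering vector orthogonal to `g`. Hence
  -- every wandering vector is a multiple of `g`.
  have hv : v - c • g = 0 := by
    refine huniq _ ?_ ?_ ?_
    · rw [map_sub, map_smul, hvA, hgA, smul_zero, sub_zero]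
    · rw [map_sub, map_smul, hvB, hgB, smul_zero, sub_zero]
    · rw [← inner_conj_symm, inner_sub_right, inner_smul_right, div_mul_cancel₀ _ hgg, sub_self,
        map_zero]
  rw [sub_eq_zero.1 hv, map_smul, map_smul, inner_smul_left,
    hx _ (Submodule.subset_span ⟨i, j, g, rfl, rfl⟩), mul_zero]

/-! ### Shifts of `ℓ²(ℕ × ℕ)` and convolution. -/

/-- The shift of a function on `ℕ × ℕ` by `n`, extended by zero. -/
def shiftFun (n : ℕ × ℕ) (f : ℕ × ℕ → ℂ) (k : ℕ × ℕ) : ℂ := if n ≤ k then f (k - n) else 0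

theorem shiftFun_add_apply (n : ℕ × ℕ) (f : ℕ × ℕ → ℂ) (k : ℕ × ℕ) :
    shiftFun n f (k + n) = f k := by
  simp [shiftFun]

theorem shiftFun_of_notMem_range (n : ℕ × ℕ) (f : ℕ × ℕ → ℂ) {k : ℕ × ℕ}
    (hk : k ∉ range (· + n)) : shiftFun n f k = 0 :=
  if_neg fun h => hk ⟨k - n, tsub_add_cancel_of_le h⟩

theorem memℓp_shiftFun (n : ℕ × ℕ) (f : lp (fun _ : ℕ × ℕ => ℂ) 2) :
    Memℓp (E := fun _ : ℕ × ℕ => ℂ) (shiftFun n f) 2 := by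
  refine memℓp_gen ?_
  rw [← (add_left_injective n).summable_iff]
  · simpa only [Function.comp_def, shiftFun_add_apply] using (lp.memℓp f).summable (by norm_num)
  · intro k hk
    simp [shiftFun_of_notMem_range n f hk]

/-- The shift of `ℓ²(ℕ × ℕ)` by `n`. -/
def shift (n : ℕ × ℕ) (f : lp (fun _ : ℕ × ℕ => ℂ) 2) : lp (fun _ : ℕ × ℕ => ℂ) 2 :=
  ⟨shiftFun n f, memℓp_shiftFun n f⟩

theorem shift_apply (n : ℕ × ℕ) (f : lp (fun _ : ℕ × ℕ => ℂ) 2) (k : ℕ × ℕ) :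
    shift n f k = if n ≤ k then f (k - n) else 0 := rfl

theorem shift_apply_add (n : ℕ × ℕ) (f : lp (fun _ : ℕ × ℕ => ℂ) 2) (k : ℕ × ℕ) :
    shift n f (k + n) = f k := shiftFun_add_apply n f k

theorem shift_shift (n m : ℕ × ℕ) (f : lp (fun _ : ℕ × ℕ => ℂ) 2) :
    shift n (shift m f) = shift (m + n) f := by
  ext k
  simp only [shift_apply]
  by_cases h : m + n ≤ k
  · rw [if_pos (le_of_add_le_right h), if_pos (le_tsub_of_add_le_right h), if_pos h, tsub_tsub,
      add_comm]
  · rw [if_neg h]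
    split_ifs with h1 h2
    · exact absurd (add_le_of_le_tsub_right_of_le h1 h2) h
    · rfl
    · rfl

theorem shift_zero (f : lp (fun _ : ℕ × ℕ => ℂ) 2) : shift 0 f = f := by
  ext k
  simp [shift_apply]

theorem inner_shift_shift (n : ℕ × ℕ) (f g : lp (fun _ : ℕ × ℕ => ℂ) 2) :
    inner ℂ (shift n f) (shift n g) = inner ℂ f g := by
  refine (lp.hasSum_inner _ _).unique ?_
  rw [← (add_left_injective n).hasSum_iff]
  · simpa only [Function.comp_def, shift_apply_add] using lp.hasSum_inner f g
  · intro k hk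
    have : shift n f k = 0 := shiftFun_of_notMem_range n f hk
    simp [this]

/-- `∑ₙ gₙ (shift by n of f)` has the convolution of `f` and `g` as its coefficients. -/
theorem apply_of_hasSum_shift {f g h : lp (fun _ : ℕ × ℕ => ℂ) 2}
    (hh : HasSum (fun n => g n • shift n f) h) (k : ℕ × ℕ) :
    h k = ∑ n ∈ Finset.Iic k, g n * f (k - n) := by
  have h1 : HasSum (fun n => g n * shift n f k) (h k) :=
    (lp.evalCLM ℂ (fun _ : ℕ × ℕ => ℂ) 2 k).hasSum hh
  have h2 := hasSum_sum_of_ne_finset_zero (f := fun n => g n * shift n f k)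
    (s := Finset.Iic k) (L := .unconditional _) fun n hn => by
      rw [shift_apply, if_neg (mt Finset.mem_Iic.2 hn), mul_zero]
  rw [h1.unique h2]
  refine Finset.sum_congr rfl fun n hn => ?_
  rw [shift_apply, if_pos (Finset.mem_Iic.1 hn)]

/-- Pairing the series with `v i` isolates `c i`. -/
theorem eq_zero_of_hasSum_of_orthonormal {ι E : Type*} [NormedAddCommGroup E]
    [InnerProductSpace ℂ E] {v : ι → E} (hv : Orthonormal ℂ v) {c : ι → ℂ}
    (hc : HasSum (fun i => c i • v i) 0) (i : ι) : c i = 0 := by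
  classical
  have h1 := (innerSL ℂ (v i)).hasSum hc
  simp only [innerSL_apply_apply, inner_smul_right, orthonormal_iff_ite.1 hv, mul_ite, mul_one,
    mul_zero, inner_zero_right, eq_comm (a := i)] at h1
  have h2 := hasSum_single (f := fun j => if j = i then c j else 0) i fun j hj => if_neg hj
  simpa using h2.unique h1

theorem summable_smul_of_orthonormal {ι E : Type*} [NormedAddCommGroup E]
    [InnerProductSpace ℂ E] [CompleteSpace E] {v : ι → E} (hv : Orthonormal ℂ v)
    (c : lp (fun _ : ι => ℂ) 2) : Summable fun i => c i • v i :=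
  hv.orthogonalFamily.summable_of_lp c

/-- If the shifts of `f` and those of `g` are orthonormal families, they are not orthogonal to
each other. -/
theorem not_orthogonal_shifts {f g : lp (fun _ : ℕ × ℕ => ℂ) 2}
    (hf : Orthonormal ℂ fun n => shift n f) (hg : Orthonormal ℂ fun n => shift n g)
    (hfg : ∀ n m, inner ℂ (shift n f) (shift m g) = 0) : False := by
  obtain ⟨h, hh⟩ := summable_smul_of_orthonormal hf g
  obtain ⟨h', hh'⟩ := summable_smul_of_orthonormal hg f
  have e : h = h' := by
    ext k
    rw [apply_of_hasSum_shift hh, apply_of_hasSum_shift hh']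
    -- Convolution is commutative: the reflection `n ↦ k - n` of `{n | n ≤ k}` exchanges the two
    -- sums.
    refine Finset.sum_nbij' (k - ·) (k - ·) (by simp) (by simp) (fun n hn => ?_) (fun n hn => ?_)
      fun n hn => ?_
    · exact tsub_tsub_cancel_of_le (Finset.mem_Iic.1 hn)
    · exact tsub_tsub_cancel_of_le (Finset.mem_Iic.1 hn)
    · rw [tsub_tsub_cancel_of_le (Finset.mem_Iic.1 hn), mul_comm]
  subst e
  have h1 : ∀ n, inner ℂ (shift n f) h = 0 := fun n => by
    have := (innerSL ℂ (shift n f)).hasSum hh'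
    simp only [innerSL_apply_apply, inner_smul_right, hfg, mul_zero] at this
    exact this.unique hasSum_zero
  -- As a series in shifts of `g`, `h` is orthogonal to every shift of `f`. As a series in shifts of
  -- `f`, it is then orthogonal to itself.
  have h2 : h = 0 := by
    have := (innerSL ℂ h).hasSum hh
    have h3 : ∀ n, inner ℂ h (shift n f) = 0 := fun n => by
      rw [← inner_conj_symm, h1, map_zero]
    simp only [innerSL_apply_apply, inner_smul_right, h3, mul_zero] at this
    exact inner_self_eq_zero.1 (this.unique hasSum_zero)
  subst h2
  have hg0 : g = 0 := by
    ext n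
    exact eq_zero_of_hasSum_of_orthonormal hf hh n
  have := hg.1 0
  simp [shift_zero, hg0] at this

/-! ### The coordinate multiplications as shifts of coefficients. -/

/-- The monomial cancels against the kernel `z^(-k) w^(-l)` pointwise on the torus, so no regularity
of `f` is involved. -/
theorem lc_mul_monomial {f h : ℂ × ℂ → ℂ} (i j : ℕ) (n n' : Fin 2 → ℤ)
    (hh : ∀ p : ℂ × ℂ, h p = p.1 ^ i * p.2 ^ j) (h0 : n 0 = n' 0 + i) (h1 : n 1 = n' 1 + j) :
    lc (h * f) n = lc f n' := by
  unfold lc laurent torusMean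
  congr 1
  refine intervalIntegral.integral_congr fun θ _ => intervalIntegral.integral_congr fun γ _ => ?_
  have hz : ((1 / 4 : ℝ) : ℂ) * Complex.exp (θ * Complex.I) ≠ 0 :=
    mul_ne_zero (by norm_num) (Complex.exp_ne_zero _)
  have hw : ((1 / 2 : ℝ) : ℂ) * Complex.exp (γ * Complex.I) ≠ 0 :=
    mul_ne_zero (by norm_num) (Complex.exp_ne_zero _)
  simp only [Pi.mul_apply, hh, h0, h1, neg_add, zpow_add₀ hz, zpow_add₀ hw, zpow_neg, zpow_natCast]
  field_simp

namespace HardySpace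

theorem coeffs_Mw (f : HardySpace) : coeffs (Mw f) = shift (0, 1) (coeffs f) := by
  ext ⟨m, n⟩
  change lc (Prod.snd * f.1) (idx (m, n)) =
    if (0, 1) ≤ (m, n) then lc f.1 (idx ((m, n) - (0, 1))) else 0
  -- The exponents `(m, n - m - 2)` are those of `idx (m, n - 1)` if `n ≥ 1`. For `n = 0` they lie
  -- outside the range of `idx`, where coefficients of Hardy functions vanish.
  rw [lc_mul_monomial 0 1 _ ![(m : ℤ), n - m - 2] (by simp) (by simp [idx])
    (by simp [idx]; ring)]
  split_ifs with h
  · have h1 : 1 ≤ n := h.2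
    congr 1
    funext i
    fin_cases i <;> simp [idx]
    lia
  · have h1 : n = 0 := by
      by_contra hn
      exact h ⟨Nat.zero_le _, Nat.one_le_iff_ne_zero.2 hn⟩
    exact lc_eq_zero f.2 _ (Or.inr (by simp [h1]; lia))

/-- Since `z = (z/w) w`, both indices rise by one. On the boundary `m = 0` or `n = 0` the exponents
`(m - 1, n - m - 1)` fall into the region covered by `lc_eq_zero`. -/
theorem coeffs_Mz (f : HardySpace) : coeffs (Mz f) = shift (1, 1) (coeffs f) := by
  ext ⟨m, n⟩
  change lc (Prod.fst * f.1) (idx (m, n)) =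
    if (1, 1) ≤ (m, n) then lc f.1 (idx ((m, n) - (1, 1))) else 0
  rw [lc_mul_monomial 1 0 _ ![(m : ℤ) - 1, n - m - 1] (by simp) (by simp [idx])
    (by simp [idx])]
  split_ifs with h
  · have h1 : 1 ≤ m := h.1
    have h2 : 1 ≤ n := h.2
    congr 1
    funext i
    fin_cases i <;> simp [idx] <;> lia
  · refine lc_eq_zero f.2 _ ?_
    by_contra! hc
    simp at hc
    exact h ⟨show 1 ≤ m by lia, show 1 ≤ n by lia⟩

theorem inner_coeffs (f g : HardySpace) : inner ℂ (coeffs f) (coeffs g) = inner ℂ f g :=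
  coeffsₗᵢ.inner_map_map f g

end HardySpace

/-! ### The pair `S_z`, `S_w` on a submodule and its wandering subspace. -/

namespace HardySubmodule

open HardySpace

variable (S : HardySubmodule)

theorem coe_Sz (f : S.carrier) : (S.Sz f : HardySpace) = Mz f := rfl

theorem coe_Sw (f : S.carrier) : (S.Sw f : HardySpace) = Mw f := rfl

theorem coeffs_Sw_pow (j : ℕ) (f : S.carrier) :
    coeffs ((S.Sw ^ j) f : S.carrier) = shift (0, j) (coeffs f) := by
  induction j with
  | zero => exact (shift_zero _).symm
  | succ j ih =>
    rw [pow_succ', clm_mul_apply, coe_Sw, coeffs_Mw, ih, shift_shift]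
    rfl

theorem coeffs_Sz_pow (i : ℕ) (f : S.carrier) :
    coeffs ((S.Sz ^ i) f : S.carrier) = shift (i, i) (coeffs f) := by
  induction i with
  | zero => exact (shift_zero _).symm
  | succ i ih =>
    rw [pow_succ', clm_mul_apply, coe_Sz, coeffs_Mz, ih, shift_shift]
    rfl

theorem coeffs_Sz_pow_Sw_pow (i j : ℕ) (f : S.carrier) :
    coeffs ((S.Sz ^ i) ((S.Sw ^ j) f) : S.carrier) = shift (i, j + i) (coeffs f) := by
  rw [coeffs_Sz_pow, coeffs_Sw_pow, shift_shift]
  simp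

theorem eq_zero_of_coeffs {f : S.carrier} (h : ∀ k, coeffs (f : HardySpace) k = 0) : f = 0 := by
  refine Subtype.ext (coeffs_injective ?_)
  ext k
  simp [h k]

theorem Sw_pure (f : S.carrier) (h : ∀ n : ℕ, ∃ g, f = (S.Sw ^ n) g) : f = 0 := by
  refine S.eq_zero_of_coeffs fun k => ?_
  -- A shift whose second component is `k.2 + 1` has zero coefficient at `k`.
  obtain ⟨g, rfl⟩ := h (k.2 + 1)
  rw [coeffs_Sw_pow, shift_apply, if_neg]
  exact fun h => (Nat.lt_irrefl _ h.2)

theorem Sz_pure (f : S.carrier) (h : ∀ n : ℕ, ∃ g, f = (S.Sz ^ n) g) : f = 0 := by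
  refine S.eq_zero_of_coeffs fun k => ?_
  obtain ⟨g, rfl⟩ := h (k.2 + 1)
  rw [coeffs_Sz_pow, shift_apply, if_neg]
  exact fun h => (Nat.lt_irrefl _ h.2)

theorem inner_eq_inner_coeffs (f g : S.carrier) :
    inner ℂ f g = inner ℂ (coeffs (f : HardySpace)) (coeffs (g : HardySpace)) :=
  (inner_coeffs _ _).symm

/-- Although the adjoint is taken in `S`, only inner products of images under `S_z` occur, and
shifts preserve these. -/
theorem star_Sz_mul_Sz : star S.Sz * S.Sz = 1 := by
  refine ContinuousLinearMap.ext fun f => ext_inner_left ℂ fun g => ?_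
  rw [clm_mul_apply, ContinuousLinearMap.star_eq_adjoint, ContinuousLinearMap.adjoint_inner_right,
    inner_eq_inner_coeffs, coe_Sz, coe_Sz, coeffs_Mz, coeffs_Mz, inner_shift_shift, inner_coeffs]
  rfl

theorem star_Sw_mul_Sw : star S.Sw * S.Sw = 1 := by
  refine ContinuousLinearMap.ext fun f => ext_inner_left ℂ fun g => ?_
  rw [clm_mul_apply, ContinuousLinearMap.star_eq_adjoint, ContinuousLinearMap.adjoint_inner_right,
    inner_eq_inner_coeffs, coe_Sw, coe_Sw, coeffs_Mw, coeffs_Mw, inner_shift_shift, inner_coeffs]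
  rfl

theorem commute_Sz_Sw : Commute S.Sz S.Sw := by
  refine ContinuousLinearMap.ext fun f => Subtype.ext (Subtype.ext (funext fun p => ?_))
  change p.1 * (p.2 * f.1.1 p) = p.2 * (p.1 * f.1.1 p)
  ring

variable {S}

/-- The elements of the wandering subspace have mutually orthogonal shifts. -/
theorem inner_shift_eq_zero (hdc : Commute (star S.Sz) S.Sw) {f g : S.carrier}
    (hfz : star S.Sz f = 0) (hfw : star S.Sw f = 0) (hgz : star S.Sz g = 0)
    (hgw : star S.Sw g = 0) {n m : ℕ × ℕ} (hnm : n ≠ m) :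
    inner ℂ (shift n (coeffs f)) (shift m (coeffs g)) = 0 := by
  -- The shift by `(a, b)` is a monomial in `S_z`, `S_w` only when `a ≤ b`. A further isometric
  -- shift by `(0, n.1 + m.1)` brings both indices into this cone without changing the inner
  -- product.
  rw [← inner_shift_shift (0, n.1 + m.1), shift_shift, shift_shift]
  -- The bound `n.1 ≤ d.2` makes the truncated exponent `n.2 + d.2 - n.1` of `S_w` exact.
  have e : ∀ n d : ℕ × ℕ, ∀ f : S.carrier, n.1 ≤ d.2 → shift (n + (0, d.2)) (coeffs (f : HardySpace))
      = coeffs ((S.Sz ^ n.1) ((S.Sw ^ (n.2 + d.2 - n.1)) f) : S.carrier) := fun n d f h => by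
    rw [coeffs_Sz_pow_Sw_pow]
    congr 1
    ext <;> simp
    lia
  rw [e n (0, n.1 + m.1) f (by simp), e m (0, n.1 + m.1) g (by simp), ← inner_eq_inner_coeffs]
  refine inner_pow_pow_eq_zero S.star_Sz_mul_Sz S.star_Sw_mul_Sw S.commute_Sz_Sw hdc hfz hfw hgz hgw
    fun h => hnm (Prod.ext h.1 ?_)
  have h1 := h.1
  have h2 := h.2
  simp only at h2
  lia

theorem orthonormal_shift (hdc : Commute (star S.Sz) S.Sw) {f : S.carrier}
    (hfz : star S.Sz f = 0) (hfw : star S.Sw f = 0) (hf : ‖f‖ = 1) :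
    Orthonormal ℂ fun n => shift n (coeffs (f : HardySpace)) := by
  refine ⟨fun n => ?_, fun n m hnm => inner_shift_eq_zero hdc hfz hfw hfz hfw hnm⟩
  rw [norm_eq_sqrt_re_inner (𝕜 := ℂ), inner_shift_shift, ← norm_eq_sqrt_re_inner, norm_coeffs]
  exact hf

/-- The wandering subspace is at most one-dimensional. -/
theorem eq_zero_of_wandering (hdc : Commute (star S.Sz) S.Sw) {f g : S.carrier}
    (hfz : star S.Sz f = 0) (hfw : star S.Sw f = 0) (hgz : star S.Sz g = 0)
    (hgw : star S.Sw g = 0) (hg : g ≠ 0) (hfg : inner ℂ f g = 0) : f = 0 := by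
  by_contra hf
  have hn : ∀ f : S.carrier, f ≠ 0 → ‖((‖f‖ : ℂ)⁻¹) • f‖ = 1 := fun f hf => by
    rw [norm_smul, norm_inv, Complex.norm_real, norm_norm, inv_mul_cancel₀ (norm_ne_zero_iff.2 hf)]
  set a := (‖f‖ : ℂ)⁻¹
  set b := (‖g‖ : ℂ)⁻¹
  have haz : star S.Sz (a • f) = 0 := by rw [map_smul, hfz, smul_zero]
  have haw : star S.Sw (a • f) = 0 := by rw [map_smul, hfw, smul_zero]
  have hbz : star S.Sz (b • g) = 0 := by rw [map_smul, hgz, smul_zero]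
  have hbw : star S.Sw (b • g) = 0 := by rw [map_smul, hgw, smul_zero]
  refine not_orthogonal_shifts (orthonormal_shift hdc haz haw (hn f hf))
    (orthonormal_shift hdc hbz hbw (hn g hg)) fun n m => ?_
  -- Equal shifts cancel and leave `f ⊥ g`; distinct shifts of wandering vectors are always
  -- orthogonal.
  by_cases hnm : n = m
  · rw [hnm, inner_shift_shift, ← inner_eq_inner_coeffs]
    exact inner_smul_smul_eq_zero hfg a b
  · exact inner_shift_eq_zero hdc haz haw hbz hbw hnm

theorem DoublyCommuting.commute (hdc : S.DoublyCommuting) : Commute (star S.Sz) S.Sw :=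
  sub_eq_zero.1 hdc

/-- With a trivial wandering space every vector satisfies the orthogonality hypothesis of
`eq_zero_of_orthogonal_wandering`, which would force `S = 0`. -/
theorem exists_wandering_ne_zero (hS : S.carrier ≠ ⊥) (hdc : Commute (star S.Sz) S.Sw) :
    ∃ g : S.carrier, star S.Sz g = 0 ∧ star S.Sw g = 0 ∧ g ≠ 0 := by
  by_contra! h
  obtain ⟨x, hx, hx0⟩ := S.carrier.exists_mem_ne_zero_of_ne_bot hS
  refine hx0 (congrArg Subtype.val (?_ : (⟨x, hx⟩ : S.carrier) = 0))
  refine eq_zero_of_orthogonal_wandering S.star_Sz_mul_Sz S.star_Sw_mul_Sw S.commute_Sz_Sw hdc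
    S.Sz_pure S.Sw_pure fun i j v hz hw => ?_
  rw [h v hz hw, map_zero, map_zero, inner_zero_left]

theorem closedSpan_wandering (hdc : Commute (star S.Sz) S.Sw) {g : S.carrier}
    (hgz : star S.Sz g = 0) (hgw : star S.Sw g = 0) (hg : g ≠ 0) :
    closedSpan S.Sz S.Sw {g} = ⊤ :=
  closedSpan_eq_top S.star_Sz_mul_Sz S.star_Sw_mul_Sw S.commute_Sz_Sw hdc S.Sz_pure S.Sw_pure
    hgz hgw hg fun _ hz hw => eq_zero_of_wandering hdc hz hw hgz hgw hg

end HardySubmodule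

/-! ### Rank bounds and conclusion. -/

theorem one_le_rank {H : Type*} [NormedAddCommGroup H] [InnerProductSpace ℂ H] [Nontrivial H]
    (T₁ T₂ : H →L[ℂ] H) : 1 ≤ rank T₁ T₂ := by
  refine le_sInf ?_
  rintro _ ⟨E, hE, rfl⟩
  rw [Order.one_le_iff_ne_zero, ne_eq, encard_eq_zero]
  rintro rfl
  have : closedSpan T₁ T₂ ∅ = ⊥ := by
    simp [closedSpan]
  exact bot_ne_top (this.symm.trans hE)

theorem rank_le_one {H : Type*} [NormedAddCommGroup H] [InnerProductSpace ℂ H]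
    {T₁ T₂ : H →L[ℂ] H} {g : H} (hg : closedSpan T₁ T₂ {g} = ⊤) : rank T₁ T₂ ≤ 1 :=
  sInf_le ⟨{g}, hg, encard_singleton g⟩

end Hartogs

end

theorem corollary2p5 (S : Hartogs.HardySubmodule) (hS : S.carrier ≠ ⊥)
    (hdc : S.DoublyCommuting) :
    Hartogs.rank S.Sz S.Sw = 1 ∧ ∃ g : S.carrier, Hartogs.closedSpan S.Sz S.Sw {g} = ⊤ := by
  obtain ⟨g, hgz, hgw, hg⟩ := Hartogs.HardySubmodule.exists_wandering_ne_zero hS hdc.commute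
  have h := Hartogs.HardySubmodule.closedSpan_wandering hdc.commute hgz hgw hg
  have : Nontrivial S.carrier := ⟨g, 0, hg⟩
  exact ⟨le_antisymm (Hartogs.rank_le_one h) (Hartogs.one_le_rank _ _), g, h⟩
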